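/- \textbf{Setting.} A (finite) t-embedding $\mathcal T$ of a finite weighted planar bipartite graph $(\mathcal G,\nu)$ is a proper embedding in $\mathbb C$ of its augmented dual $\mathcal G^*$: the bounded faces are nondegenerate closed convex polygons indexed by the vertices of $\mathcal G$ (black and white faces, two faces sharing an edge having different colours), they have disjoint interiors and fit together along whole edges, their union $\Omega_{\mathcal T}$ has connected interior and connected complement; at every inner vertex (a vertex in the interior of $\Omega_{\mathcal T}$) the angles of the black faces sum to $\pi$, and so do the angles of the white faces; and the lengths of the dual edges are gauge equivalent to $\nu$. No further condition is imposed at the boundary, so perfect t-embeddings are included. Let $\eta$ be an origami square root function: a unimodular function on the faces, with $\eta^2$ single valued, such that $\overline{\eta}_b\,\overline{\eta}_w=d\mathcal T/|d\mathcal T|$ on each edge between $w$ and $b$ oriented with $w$ on its left. An origami map $\mathcal O:\Omega_{\mathcal T}\to\mathbb C$ is a primitive of the form equal to $\eta_w^2\,dz$ on white faces $w$ and $\overline{\eta}_b^{\,2}\,d\bar z$ on black faces $b$. For $\kappa\in(0,1)$, $\mathcal T$ satisfies $\mathrm{Lip}(\kappa,\delta)$ on a compact set $K$ if $|\mathcal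 O(z')-\mathcal O(z)|\le\kappa|z'-z|$ for all $z,z'\in K$ with $|z'-z|\ge\delta$. Let $\mathcal T_n$ be a sequence of t-embeddings with origami maps $\mathcal O_n$, such that all vertices of all dual graphs $\mathcal G_n^*$ have degree less than a constant $D$. Let $\Omega\subset\mathbb C$ be a non-empty bounded convex open set such that $\Omega_{\mathcal T_n}\to\Omega$ in the Hausdorff distance and each compact subset of $\Omega$ is contained in $\Omega_{\mathcal T_n}$ for all large $n$. For positive numbers $\mu_n$ and a compact set $S\subset\Omega$, we say that the rigidity condition with scales $\mu_n$ holds on $S$ with constants $N\in\mathbb N$, $C>0$, $\varepsilon>0$ if, for every $n>N$ and every face of $\mathcal T_n$ meeting $S$, all the edges of this face have length in $[\mu_n/C,\;C\mu_n]$ and all its angles lie in $(\varepsilon,\pi-\varepsilon)$. \textbf{Proposition.} Let $\mu_n>0$, $\mu_n\to0$, let $K\subset\Omega$ be compact, and suppose that the rigidity condition with scales $\mu_n$ holds on the convex hull of $K$ with constants $N$, $C$, $\varepsilon$. Then there are constants $\kappa\in(0,1)$ and $C'>0$, not depending on $n$, such that for all $n>N$ the t-embedding $\mathcal T_n$ satisfies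 $\mathrm{Lip}(\kappa,C'\mu_n)$ on $K$, and $$|\mathcal O_n(z)-\mathcal O_n(z')|<\kappa|z-z'|\qquad\text{for all } z,z'\in K \text{ with } |z-z'|>C'\mu_n .$$ \textbf{Corollary.} If the rigidity condition with scales $\mu_n=1/n$ holds on every compact subset of $\Omega$ (with constants depending on the subset), then, with $\delta_n=\frac{\log n}{n}\to0$, for every compact $K\subset\Omega$ there is $\kappa\in(0,1)$ such that for all large $n$ the t-embedding $\mathcal T_n$ satisfies $\mathrm{Lip}(\kappa,\delta_n)$ on $K$. -/

import Mathlib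

/-- Combinatorial and geometric data of a finite polygonal complex drawn in the plane with
two-coloured faces. It records the augmented dual `G*` of a finite planar bipartite graph `G`:
`V` is the set of vertices of `G*`, `F` is the set of its bounded faces (the vertices of `G`),
coloured black or white, `pos` is the drawing. The boundary cycle of the face `f` has `size f`
corners; it is stored as a periodic sequence `corner f : ℤ → V`, in counterclockwise order. -/
structure ColoredDrawing (V F : Type*) where
  pos : V → ℂ
  black : F → Bool
  size : F → ℕ
  corner : F → ℤ → V

namespace ColoredDrawing

variable {V F : Type*}

/-- The position of the `i`-th corner of the face `f`. -/
def pt (T : ColoredDrawing V F) (f : F) (i : ℤ) : ℂ := T.pos (T.corner f i)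

/-- The closed polygon which is the face `f` (all faces will be convex). -/
def face (T : ColoredDrawing V F) (f : F) : Set ℂ := convexHull ℝ (Set.range (T.pt f))

/-- The discrete domain: the union of all the closed faces. -/
def region (T : ColoredDrawing V F) : Set ℂ := ⋃ f, T.face f

/-- The angle of the convex polygon `f` at its `i`-th corner. -/
noncomputable def angle (T : ColoredDrawing V F) (f : F) (i : ℤ) : ℝ :=
  EuclideanGeometry.angle (T.pt f (i - 1)) (T.pt f i) (T.pt f (i + 1))

/-- `u → v` is an edge of the boundary cycle of `f`, with `f` on its left. -/
def HasEdge (T : ColoredDrawing V F) (f : F) (u v : V) : Prop :=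
  ∃ i : ℤ, T.corner f i = u ∧ T.corner f (i + 1) = v

/-- Two vertices are adjacent if they are joined by an edge of some face. -/
def VAdj (T : ColoredDrawing V F) (u v : V) : Prop :=
  ∃ f, T.HasEdge f u v ∨ T.HasEdge f v u

/-- The degree of a vertex of the augmented dual graph. -/
noncomputable def degree (T : ColoredDrawing V F) (v : V) : ℕ := {u | T.VAdj v u}.ncard

open Classical in
/-- The sum of the angles at the vertex `v` of the faces of colour `c`. -/
noncomputable def angleSum [Fintype F] (T : ColoredDrawing V F) (c : Bool) (v : V) : ℝ :=
  ∑ f : F, if T.black f = c then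
    ∑ i ∈ Finset.range (T.size f), if T.corner f i = v then T.angle f i else 0
  else 0

/-- The drawing is a proper embedding: the faces are nondegenerate convex polygons with
counterclockwise boundary cycles, they have disjoint interiors and fit together along whole edges,
and their union is a closed topological disc (connected interior and connected complement, so that
the complement of the region is the single outer face). -/
structure IsProper (T : ColoredDrawing V F) : Prop where
  pos_injective : Function.Injective T.pos
  exists_corner : ∀ v, ∃ f i, T.corner f i = v
  three_le_size : ∀ f, 3 ≤ T.size f
  corner_eq_iff : ∀ f i j, T.corner f i = T.corner f j ↔ i ≡ j [ZMOD T.size f]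
  convex_left : ∀ f i j,
    0 ≤ ((starRingEnd ℂ) (T.pt f (i + 1) - T.pt f i) * (T.pt f j - T.pt f i)).im
  interior_nonempty : ∀ f, (interior (T.face f)).Nonempty
  interior_disjoint : ∀ f g, f ≠ g → Disjoint (interior (T.face f)) (interior (T.face g))
  corner_of_mem : ∀ v f, T.pos v ∈ T.face f → ∃ i, T.corner f i = v
  interior_connected : IsConnected (interior T.region)
  compl_connected : IsConnected (T.region)ᶜ

/-- `T` is a t-embedding of the bipartite graph `G` with edge weights `ν`. The edges of `G` are
labelled by their dual edges `s(u, v)`. -/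
structure IsTEmbedding [Fintype F] (T : ColoredDrawing V F) (ν : Sym2 V → ℝ) : Prop where
  proper : T.IsProper
  /-- the graph `G` is bipartite: the two faces at an interior edge have different colours -/
  bipartite : ∀ f g u v, T.HasEdge f u v → T.HasEdge g v u → T.black f ≠ T.black g
  /-- the angle condition at every inner vertex -/
  angle_condition : ∀ v, T.pos v ∈ interior T.region → ∀ c, T.angleSum c v = Real.pi
  /-- the geometric weights (lengths of the dual edges) are gauge equivalent to `ν` -/
  gauge_equivalent : ∃ g : F → ℝ, (∀ f, 0 < g f) ∧
    ∀ f f' u v, T.HasEdge f u v → T.HasEdge f' v u →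
      dist (T.pos u) (T.pos v) = g f * ν s(u, v) * g f'

/-- `O` is an origami map of `T`, i.e. a primitive of the form equal to `η_w² dz` on white faces
and `conj (η_b²) d(conj z)` on black faces, where `η` is an origami square root function. Only the
single-valued function `ζ = η²` enters; the defining relation `conj η_b * conj η_w = dT / |dT|`
(edge `u → v` with the white face on its left) is squared. -/
def IsOrigamiMap (T : ColoredDrawing V F) (O : ℂ → ℂ) : Prop :=
  ∃ ζ : F → ℂ, (∀ f, ‖ζ f‖ = 1) ∧
    (∀ w b u v, T.black w = false → T.black b = true → T.HasEdge w u v → T.HasEdge b v u →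
      (starRingEnd ℂ) (ζ b) * (starRingEnd ℂ) (ζ w) =
        ((T.pos v - T.pos u) / (‖T.pos v - T.pos u‖ : ℂ)) ^ 2) ∧
    (∀ w, T.black w = false → ∀ z ∈ T.face w, ∀ z' ∈ T.face w,
      O z - O z' = ζ w * (z - z')) ∧
    (∀ b, T.black b = true → ∀ z ∈ T.face b, ∀ z' ∈ T.face b,
      O z - O z' = (starRingEnd ℂ) (ζ b) * (starRingEnd ℂ) (z - z'))

/-- All the edges of the faces of `T` that meet `S` have length between `m / C` and `m * C`, and
all the angles of these faces lie in `(ε, π - ε)`. -/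
def RigidOn (T : ColoredDrawing V F) (S : Set ℂ) (m C ε : ℝ) : Prop :=
  ∀ f, (T.face f ∩ S).Nonempty → ∀ i : ℤ,
    m / C ≤ dist (T.pt f (i + 1)) (T.pt f i) ∧ dist (T.pt f (i + 1)) (T.pt f i) ≤ m * C ∧
      ε < T.angle f i ∧ T.angle f i < Real.pi - ε

end ColoredDrawing

/-- The rigidity condition on `S` at the scales `μ n`, with constants `N`, `C`, `ε`. -/
def RigidityCondition {V F : ℕ → Type*} (T : ∀ n, ColoredDrawing (V n) (F n)) (μ : ℕ → ℝ)
    (S : Set ℂ) (N : ℕ) (C ε : ℝ) : Prop :=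
  0 < C ∧ 0 < ε ∧ ∀ n, N < n → (T n).RigidOn S (μ n) C ε

/-- The condition `Lip(κ, δ)` on `K` for a t-embedding with origami map `O`. -/
def LipOn (O : ℂ → ℂ) (K : Set ℂ) (κ δ : ℝ) : Prop :=
  ∀ z ∈ K, ∀ z' ∈ K, δ ≤ ‖z' - z‖ → ‖O z' - O z‖ ≤ κ * ‖z' - z‖

/-- The Lipschitz assumption on compact subsets of `Ω` for a sequence of t-embeddings with origami
maps `O n` and scales `δ n → 0`. -/
def LipOnCompacts (O : ℕ → ℂ → ℂ) (Ω : Set ℂ) (δ : ℕ → ℝ) : Prop :=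
  Filter.Tendsto δ Filter.atTop (nhds 0) ∧
    ∀ K : Set ℂ, IsCompact K → K ⊆ Ω →
      ∃ κ : ℝ, 0 < κ ∧ κ < 1 ∧ ∀ᶠ n in Filter.atTop, LipOn (O n) K κ (δ n)

/-! An origami map is isometric on every face, so it does not lengthen segments inside the region
(`IsOrigamiMap.norm_sub_le`). Along an edge shared by two faces of different colours it folds the
plane: points that are mirror images in the edge have the same image (`IsOrigamiMap.eq_of_mirror`).
Strict contraction comes from finding such a fold on every segment whose length is a large multiple
of the scale.

Take a long segment with midpoint `c` and direction `e`, and a face containing `c`. Rigidity bounds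
the diameter of the face (`StrictPolygon.norm_sub_le`) and gives it an edge that meets the line of
the segment and is uniformly transverse to it (`exists_transverse_edge`). Beyond this edge lies
another face with the same edge reversed (`exists_face_across`, `exists_reversed_edge`), and both
faces contain a perpendicular of definite length at its midpoint (`normal_mem`). Its endpoints are
identified by the origami map, and one lies ahead of the other in the direction `e` by a fixed
multiple of the scale. Going to the first endpoint and on from the second saves this advance; the
lateral detour costs only the square of the scale divided by the length of the segment
(`detour_le`). So the image loses a fixed multiple of the scale (`norm_sub_le_sub`).

Cutting a segment into pieces of such a length makes the loss proportional to its length, with a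
ratio in which the scale cancels. -/

/-- The signed area of the parallelogram spanned by two vectors of the plane. -/
noncomputable def planeCross (a b : ℂ) : ℝ := ((starRingEnd ℂ) a * b).im

theorem planeCross_eq (a b : ℂ) : planeCross a b = a.re * b.im - a.im * b.re := by
  simp [planeCross, Complex.mul_im]; ring

theorem abs_planeCross_le (a b : ℂ) : |planeCross a b| ≤ ‖a‖ * ‖b‖ := by
  calc |planeCross a b| ≤ ‖(starRingEnd ℂ) a * b‖ := Complex.abs_im_le_norm _
    _ = ‖a‖ * ‖b‖ := by simp

theorem Complex.re_sq_add_im_sq_eq (a : ℂ) : a.re ^ 2 + a.im ^ 2 = ‖a‖ ^ 2 := by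
  rw [Complex.sq_norm, Complex.normSq_apply]; ring

theorem planeCross_mem_convexHull_nonneg {S : Set ℂ} {a b : ℂ}
    (h : ∀ z ∈ S, 0 ≤ planeCross a (z - b)) {z : ℂ} (hz : z ∈ convexHull ℝ S) :
    0 ≤ planeCross a (z - b) := by
  have hconv : Convex ℝ {z : ℂ | 0 ≤ planeCross a (z - b)} := by
    intro x hx y hy s t hs ht hst
    have hx' : 0 ≤ planeCross a (x - b) := hx
    have hy' : 0 ≤ planeCross a (y - b) := hy
    have : planeCross a (s • x + t • y - b) =
        s * planeCross a (x - b) + t * planeCross a (y - b) := by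
      obtain rfl : t = 1 - s := by linarith
      simp [planeCross_eq]; ring
    change 0 ≤ planeCross a (s • x + t • y - b)
    rw [this]; positivity
  exact convexHull_min h hconv hz

/-! ### Quantitatively strictly convex polygons: corners and transverse edges. -/

/-- A closed polygon `p`, convex and counterclockwise, with edges of length at most `A` and with
two successive edges spanning an area at least `q * A ^ 2`. -/
structure StrictPolygon (p : ℤ → ℂ) (A q : ℝ) : Prop where
  A_pos : 0 < A
  q_pos : 0 < q
  periodic : ∃ N : ℕ, 0 < N ∧ ∀ i, p (i + N) = p i
  left : ∀ i j, 0 ≤ planeCross (p (i + 1) - p i) (p j - p i)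
  turn : ∀ i, q * A ^ 2 ≤ planeCross (p (i + 1) - p i) (p (i + 2) - p (i + 1))
  len : ∀ i, ‖p (i + 1) - p i‖ ≤ A

namespace StrictPolygon

variable {p : ℤ → ℂ} {A q : ℝ}

theorem turn_pos (h : StrictPolygon p A q) (i : ℤ) :
    0 < planeCross (p (i + 1) - p i) (p (i + 2) - p (i + 1)) :=
  lt_of_lt_of_le (mul_pos h.q_pos (pow_pos h.A_pos 2)) (h.turn i)

theorem norm_pos (h : StrictPolygon p A q) (i : ℤ) : 0 < ‖p (i + 1) - p i‖ := by
  rw [norm_pos_iff]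
  intro h0
  have := h.turn_pos i
  rw [h0] at this
  simp [planeCross_eq] at this

theorem left_of_mem (h : StrictPolygon p A q) (i : ℤ) {z : ℂ}
    (hz : z ∈ convexHull ℝ (Set.range p)) : 0 ≤ planeCross (p (i + 1) - p i) (z - p i) := by
  refine planeCross_mem_convexHull_nonneg ?_ hz
  rintro _ ⟨j, rfl⟩
  exact h.left i j

/-- Corners are extreme points. -/
theorem corner_not_between (h : StrictPolygon p A q) (j : ℤ) {a b : ℂ}
    (ha : a ∈ convexHull ℝ (Set.range p)) (hb : b ∈ convexHull ℝ (Set.range p)) {l : ℝ}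
    (hl0 : 0 < l) (hl1 : l < 1) (hj : p j = a + l • (b - a)) : a = b := by
  have h1 := h.left_of_mem j ha
  have h2 := h.left_of_mem j hb
  have h3 := h.left_of_mem (j - 1) ha
  have h4 := h.left_of_mem (j - 1) hb
  have h5 := h.turn_pos (j - 1)
  have h6 := h.left (j - 1) j
  rw [show j - 1 + 2 = j + 1 by ring] at h5
  rw [show j - 1 + 1 = j by ring] at h3 h4 h5 h6
  set E := p (j + 1) - p j with hE
  set G := p j - p (j - 1) with hG
  have e1 : a - p j = (-l : ℝ) • (b - a) := by rw [hj]; simp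
  have e2 : b - p j = (1 - l : ℝ) • (b - a) := by rw [hj, sub_smul]; simp; ring
  have e3 : a - p (j - 1) = (-l : ℝ) • (b - a) + G := by rw [← e1, hG]; ring
  have e4 : b - p (j - 1) = (1 - l : ℝ) • (b - a) + G := by rw [← e2, hG]; ring
  rw [e1] at h1; rw [e2] at h2; rw [e3] at h3; rw [e4] at h4
  set w := b - a with hw
  simp only [planeCross_eq, Complex.add_re, Complex.add_im, Complex.smul_re, Complex.smul_im,
    smul_eq_mul] at h1 h2 h3 h4 h5
  -- From `p j`, the points `a` and `b` lie in opposite directions and both on the left of each of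
  -- the two edges at `p j`. So `w` is parallel to both edges, which are independent.
  have k1 : E.re * w.im - E.im * w.re = 0 := by
    apply le_antisymm
    · by_contra hc; push Not at hc; nlinarith
    · by_contra hc; push Not at hc; nlinarith
  have k2 : G.re * w.im - G.im * w.re = 0 := by
    apply le_antisymm
    · by_contra hc; push Not at hc; nlinarith
    · by_contra hc; push Not at hc; nlinarith
  have k3 : (G.re * E.im - G.im * E.re) * w.re = 0 := by
    linear_combination E.re * k2 - G.re * k1
  have k4 : (G.re * E.im - G.im * E.re) * w.im = 0 := by
    linear_combination E.im * k2 - G.im * k1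
  have k5 : w.re = 0 := by
    rcases mul_eq_zero.1 k3 with hh | hh
    · exact absurd hh h5.ne'
    · exact hh
  have k6 : w.im = 0 := by
    rcases mul_eq_zero.1 k4 with hh | hh
    · exact absurd hh h5.ne'
    · exact hh
  have : w = 0 := Complex.ext k5 k6
  exact (sub_eq_zero.1 this).symm

/-- If the side from `p i` to `p j` has the whole polygon on its left, it is an edge. -/
theorem next_corner_eq (h : StrictPolygon p A q) {i j : ℤ} (hij : p i ≠ p j)
    (hleft : ∀ k, 0 ≤ planeCross (p j - p i) (p k - p i)) : p (i + 1) = p j := by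
  have hm : ∀ k, p k ∈ convexHull ℝ (Set.range p) := fun k => subset_convexHull ℝ _ ⟨k, rfl⟩
  have h1 := h.left i j
  have h2 := hleft (i + 1)
  have h3 := hleft (i - 1)
  have h4 := h.turn_pos (i - 1)
  rw [show i - 1 + 2 = i + 1 by ring, show i - 1 + 1 = i by ring] at h4
  set v := p j - p i with hv
  set E := p (i + 1) - p i with hE
  have e3 : p (i - 1) - p i = -(p i - p (i - 1)) := by ring
  rw [e3] at h3
  set G := p i - p (i - 1) with hG
  simp only [planeCross_eq, Complex.neg_re, Complex.neg_im] at h1 h2 h3 h4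
  have k1 : E.re * v.im - E.im * v.re = 0 := by linarith
  have hv0 : v ≠ 0 := sub_ne_zero.2 hij.symm
  have hvp : 0 < v.re ^ 2 + v.im ^ 2 := by
    rw [Complex.re_sq_add_im_sq_eq]; exact pow_pos (norm_pos_iff.2 hv0) 2
  obtain ⟨l, hl⟩ : ∃ l : ℝ, E = l • v := by
    refine ⟨(E.re * v.re + E.im * v.im) / (v.re ^ 2 + v.im ^ 2), ?_⟩
    apply Complex.ext
    · simp only [Complex.smul_re, smul_eq_mul]
      field_simp
      linear_combination v.im * k1
    · simp only [Complex.smul_im, smul_eq_mul]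
      field_simp
      linear_combination (-v.re) * k1
  have hlpos : 0 < l := by
    have : 0 < l * (G.re * v.im - G.im * v.re) := by
      rw [hl] at h4
      simp only [Complex.smul_re, Complex.smul_im, smul_eq_mul] at h4
      linarith
    by_contra hc
    push Not at hc
    nlinarith
  -- The edge and the side point the same way; if their lengths differed, the end of the shorter one
  -- would lie strictly inside the longer one, against extremality of corners.
  rcases lt_trichotomy l 1 with hl1 | hl1 | hl1
  · exact absurd (h.corner_not_between (i + 1) (hm i) (hm j) hlpos hl1
      (by rw [← hv, ← hl, hE]; ring)) hij
  · rw [hl1, one_smul] at hl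
    exact sub_left_injective hl
  · have hp : p i = p (i + 1) := by
      refine h.corner_not_between j (hm i) (hm (i + 1)) (l := l⁻¹) (by positivity)
        (inv_lt_one_of_one_lt₀ hl1) ?_
      rw [← hE, hl, smul_smul, inv_mul_cancel₀ hlpos.ne', one_smul, hv]; ring
    have := h.norm_pos i
    rw [hp] at this
    simp at this

/-- A height function on the corners that takes both signs changes sign along some edge. -/
theorem exists_sign_change (h : StrictPolygon p A q) {f : ℂ → ℝ} {a b : ℤ} (ha : f (p a) ≤ 0)
    (hb : 0 ≤ f (p b)) : ∃ i, f (p i) ≤ 0 ∧ 0 ≤ f (p (i + 1)) := by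
  obtain ⟨N, hN, hper⟩ := h.periodic
  have hper' : ∀ k : ℕ, p (b + k * N) = p b := by
    intro k
    induction k with
    | zero => simp
    | succ k ih => rw [← ih, ← hper (b + k * N)]; congr 1; push_cast; ring
  -- The least such `n` gives the edge. Requiring `1 ≤ n` leaves a predecessor, possibly `a` itself,
  -- where `f` is nonpositive.
  have hex : ∃ n : ℕ, 1 ≤ n ∧ 0 ≤ f (p (a + n)) := by
    refine ⟨(b + ((a - b).natAbs + 1 : ℕ) * N - a).toNat, ?_, ?_⟩
    · have : 1 ≤ b + ((a - b).natAbs + 1 : ℕ) * (N : ℤ) - a := by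
        have : (((a - b).natAbs + 1 : ℕ) : ℤ) ≤ ((a - b).natAbs + 1 : ℕ) * (N : ℤ) := by
          have : (1 : ℤ) ≤ N := by exact_mod_cast hN
          nlinarith [Int.natCast_nonneg ((a - b).natAbs + 1)]
        omega
      omega
    · have : 1 ≤ b + ((a - b).natAbs + 1 : ℕ) * (N : ℤ) - a := by
        have : (((a - b).natAbs + 1 : ℕ) : ℤ) ≤ ((a - b).natAbs + 1 : ℕ) * (N : ℤ) := by
          have : (1 : ℤ) ≤ N := by exact_mod_cast hN
          nlinarith [Int.natCast_nonneg ((a - b).natAbs + 1)]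
        omega
      rw [Int.toNat_of_nonneg (by omega)]
      rw [show a + (b + ((a - b).natAbs + 1 : ℕ) * (N : ℤ) - a)
        = b + ((a - b).natAbs + 1 : ℕ) * (N : ℤ) by ring, hper']
      exact hb
  classical
  obtain ⟨hn1, hn2⟩ := Nat.find_spec hex
  have hmin := fun m => Nat.find_min hex (m := m)
  set n := Nat.find hex
  refine ⟨a + n - 1, ?_, by rw [show a + n - 1 + 1 = a + (n : ℤ) by ring]; exact hn2⟩
  rcases eq_or_lt_of_le hn1 with hn | hn
  · rw [← hn]; simpa using ha
  · have := hmin (n - 1) (by omega)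
    push Not at this
    have h2 := this (by omega)
    rw [show ((n - 1 : ℕ) : ℤ) = n - 1 by omega, ← add_sub_assoc] at h2
    exact h2.le

theorem exists_corner_nonneg {e c : ℂ} (hc : c ∈ convexHull ℝ (Set.range p)) :
    ∃ i, 0 ≤ planeCross e (p i - c) := by
  by_contra hcon
  push Not at hcon
  have hconv : Convex ℝ {z : ℂ | planeCross e (z - c) < 0} := by
    intro x hx y hy s t hs ht hst
    have hx' : planeCross e (x - c) < 0 := hx
    have hy' : planeCross e (y - c) < 0 := hy
    have : planeCross e (s • x + t • y - c) =
        s * planeCross e (x - c) + t * planeCross e (y - c) := by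
      obtain rfl : t = 1 - s := by linarith
      simp [planeCross_eq]; ring
    change planeCross e (s • x + t • y - c) < 0
    rw [this]
    rcases eq_or_lt_of_le hs with h0 | h0
    · have : t = 1 := by linarith
      rw [← h0, this]; linarith
    · nlinarith
  have := convexHull_min (by rintro _ ⟨i, rfl⟩; exact hcon i) hconv hc
  simp [planeCross_eq] at this

/-- A line through a point of the polygon touches an edge that is transverse to it. -/
theorem exists_transverse_edge (h : StrictPolygon p A q) {e c : ℂ} (he : ‖e‖ = 1)
    (hc : c ∈ convexHull ℝ (Set.range p)) :
    ∃ k, q * A / 2 ≤ |planeCross e (p (k + 1) - p k)| ∧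
      ∃ x ∈ segment ℝ (p k) (p (k + 1)), planeCross e (x - c) = 0 := by
  have hA := h.A_pos
  have hq := h.q_pos
  have key : ∃ k, q * A / 2 ≤ |planeCross e (p (k + 1) - p k)| ∧
      ((planeCross e (p k - c) ≤ 0 ∧ 0 ≤ planeCross e (p (k + 1) - c)) ∨
        (planeCross e (p (k + 1) - c) ≤ 0 ∧ 0 ≤ planeCross e (p k - c))) := by
    obtain ⟨b, hb⟩ := exists_corner_nonneg (e := e) hc
    obtain ⟨a, ha⟩ := exists_corner_nonneg (e := -e) hc
    have ha' : planeCross e (p a - c) ≤ 0 := by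
      simp only [planeCross_eq, Complex.neg_re, Complex.neg_im] at ha ⊢; linarith
    obtain ⟨i, hi0, hi1⟩ := h.exists_sign_change (f := fun z => planeCross e (z - c)) ha' hb
    by_cases htr : q * A / 2 ≤ |planeCross e (p (i + 1) - p i)|
    · exact ⟨i, htr, Or.inl ⟨hi0, hi1⟩⟩
    -- The crossing edge is now nearly parallel to `e`. Since the turns have area at least `q * A ^
    -- 2`, a neighbouring edge, chosen by the sign of `x1`, must descend by at least `q * A / 2`.
    -- This exceeds the rise `Y1`, so the neighbour crosses the line too.
    push Not at htr
    have t0 := h.turn (i - 1)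
    have t1 := h.turn i
    have l0 := h.len (i - 1)
    have l2 := h.len (i + 1)
    have l1 := h.len i
    rw [show i - 1 + 2 = i + 1 by ring, show i - 1 + 1 = i by ring] at t0
    rw [show i - 1 + 1 = i by ring] at l0
    rw [show i + 1 + 1 = i + 2 by ring] at l2
    have hdot : ∀ w : ℂ, |e.re * w.re + e.im * w.im| ≤ ‖w‖ := by
      intro w
      have := Complex.abs_re_le_norm ((starRingEnd ℂ) e * w)
      simpa [Complex.mul_re, he] using this
    have he2 := Complex.re_sq_add_im_sq_eq e
    rw [he] at he2
    have y1 : planeCross e (p (i + 1) - p i) =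
        planeCross e (p (i + 1) - c) - planeCross e (p i - c) := by
      simp [planeCross_eq]; ring
    have y0 : planeCross e (p i - p (i - 1)) =
        planeCross e (p i - c) - planeCross e (p (i - 1) - c) := by
      simp [planeCross_eq]; ring
    have y2 : planeCross e (p (i + 2) - p (i + 1)) =
        planeCross e (p (i + 2) - c) - planeCross e (p (i + 1) - c) := by
      simp [planeCross_eq]; ring
    have hdec : ∀ u v : ℂ, planeCross u v =
        (e.re * u.re + e.im * u.im) * planeCross e v
          - planeCross e u * (e.re * v.re + e.im * v.im) := by
      intro u v
      simp only [planeCross_eq]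
      linear_combination (- (u.re * v.im - u.im * v.re)) * he2
    rw [hdec] at t0 t1
    have d0 := (hdot (p i - p (i - 1))).trans l0
    have d1 := (hdot (p (i + 1) - p i)).trans l1
    have d2 := (hdot (p (i + 2) - p (i + 1))).trans l2
    set x0 := e.re * (p i - p (i - 1)).re + e.im * (p i - p (i - 1)).im
    set x1 := e.re * (p (i + 1) - p i).re + e.im * (p (i + 1) - p i).im
    set x2 := e.re * (p (i + 2) - p (i + 1)).re + e.im * (p (i + 2) - p (i + 1)).im
    set Y0 := planeCross e (p i - p (i - 1))
    set Y1 := planeCross e (p (i + 1) - p i)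
    set Y2 := planeCross e (p (i + 2) - p (i + 1))
    have hY1 : 0 ≤ Y1 := by linarith
    rw [abs_of_nonneg hY1] at htr
    rw [abs_le] at d0 d1 d2
    rcases le_or_gt 0 x1 with hx | hx
    · -- the previous edge comes down steeply
      have k1 : Y0 * x1 ≤ - (q * A / 2) * A := by nlinarith
      have k2 : Y0 ≤ -(q * A / 2) := by
        by_contra hcon
        push Not at hcon
        have : 0 < q * A / 2 := by positivity
        nlinarith
      refine ⟨i - 1, ?_, Or.inr ?_⟩
      · rw [show i - 1 + 1 = i by ring]
        exact le_trans (by linarith) (neg_le_abs _)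
      · rw [show i - 1 + 1 = i by ring]
        exact ⟨hi0, by linarith⟩
    · have k1 : (-x1) * Y2 ≤ - (q * A / 2) * A := by nlinarith
      have k2 : Y2 ≤ -(q * A / 2) := by
        by_contra hcon
        push Not at hcon
        have : 0 < q * A / 2 := by positivity
        nlinarith
      refine ⟨i + 1, ?_, Or.inr ?_⟩
      · rw [show i + 1 + 1 = i + 2 by ring]
        exact le_trans (by linarith) (neg_le_abs _)
      · rw [show i + 1 + 1 = i + 2 by ring]
        exact ⟨by linarith, hi1⟩
  obtain ⟨k, hk, hs⟩ := key
  refine ⟨k, hk, ?_⟩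
  set a := planeCross e (p k - c) with ha
  set b := planeCross e (p (k + 1) - c) with hb
  have hab : planeCross e (p (k + 1) - p k) = b - a := by
    rw [ha, hb]; simp [planeCross_eq]; ring
  have hne : b - a ≠ 0 := by
    intro h0
    rw [hab, h0, abs_zero] at hk
    have : 0 < q * A / 2 := by positivity
    linarith
  refine ⟨p k + (-a / (b - a)) • (p (k + 1) - p k), ?_, ?_⟩
  · rw [segment_eq_image']
    refine ⟨-a / (b - a), ⟨?_, ?_⟩, rfl⟩
    · rcases hs with ⟨h1, h2⟩ | ⟨h1, h2⟩
      · exact div_nonneg (by linarith) (by linarith)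
      · exact div_nonneg_of_nonpos (by linarith) (by linarith)
    · rcases hs with ⟨h1, h2⟩ | ⟨h1, h2⟩
      · rw [div_le_one (lt_of_le_of_ne (by linarith) hne.symm)]; linarith
      · rw [div_le_one_of_neg (lt_of_le_of_ne (by linarith) hne)]; linarith
  · have : planeCross e (p k + (-a / (b - a)) • (p (k + 1) - p k) - c) =
        a + (-a / (b - a)) * planeCross e (p (k + 1) - p k) := by
      rw [ha]; generalize (-planeCross e (p k - c) / (b - planeCross e (p k - c))) = l
      simp [planeCross_eq]; ring
    rw [this, hab]; field_simp; ring

end StrictPolygon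

/-! ### Diameter and thickness of a strictly convex polygon. -/

namespace StrictPolygon

variable {p : ℤ → ℂ} {A q : ℝ}

/-- For angles `α`, `β` in `[0, π]` with `sin (β - α) ≥ q`, use `(cos α - cos β) (1 + cos (β - α)) =
(sin α + sin β) sin (β - α)`: the second factor on the left is at most 2 and the sum of sines is at
least `q`. -/
theorem cos_gap_of_cross {c₁ s₁ c₂ s₂ q : ℝ} (h₁ : c₁ ^ 2 + s₁ ^ 2 = 1) (h₂ : c₂ ^ 2 + s₂ ^ 2 = 1)
    (hs₁ : 0 ≤ s₁) (hs₂ : 0 ≤ s₂) (hq : 0 < q) (h : q ≤ c₁ * s₂ - s₁ * c₂) :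
    q ^ 2 / 2 ≤ c₁ - c₂ := by
  have hid : (c₁ - c₂) * (1 + (c₁ * c₂ + s₁ * s₂)) = (s₁ + s₂) * (c₁ * s₂ - s₁ * c₂) := by
    linear_combination c₂ * h₁ - c₁ * h₂
  have hc₁ : -1 ≤ c₁ ∧ c₁ ≤ 1 := by constructor <;> nlinarith
  have hc₂ : -1 ≤ c₂ ∧ c₂ ≤ 1 := by constructor <;> nlinarith
  have hsum : q ≤ s₁ + s₂ := by nlinarith
  have hd0 : 0 ≤ 1 + (c₁ * c₂ + s₁ * s₂) := by nlinarith [sq_nonneg (c₁ + c₂), sq_nonneg (s₁ + s₂)]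
  have hd2 : 1 + (c₁ * c₂ + s₁ * s₂) ≤ 2 := by nlinarith [sq_nonneg (c₁ - c₂), sq_nonneg (s₁ - s₂)]
  have hpos : q ^ 2 ≤ (c₁ - c₂) * (1 + (c₁ * c₂ + s₁ * s₂)) := by rw [hid]; nlinarith
  have hc : 0 ≤ c₁ - c₂ := by
    by_contra hcon
    push Not at hcon
    nlinarith [pow_pos hq 2]
  nlinarith

/-- Starting along a weakly rising edge one reaches the highest corner in a bounded number of
steps. -/
theorem exists_highest (h : StrictPolygon p A q) {e : ℂ} (he : ‖e‖ = 1) {i : ℤ}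
    (hi : 0 ≤ planeCross e (p (i + 1) - p i)) :
    ∃ j, planeCross e (p (j + 1) - p j) < 0 ∧
      planeCross e (p j - p i) ≤ (4 / q ^ 2 + 1) * A ∧
      ∀ k, planeCross e (p k - p j) ≤ 0 := by
  have hA := h.A_pos
  have hq := h.q_pos
  -- The cosine of the angle from `e` to the `j`-th edge. While edges rise it drops by at least `q ^
  -- 2 / 2` at each turn; as it stays in `[-1, 1]`, there are at most `4 / q ^ 2` turns, and each
  -- edge climbs at most `A`.
  let c : ℤ → ℝ := fun j => (e.re * (p (j + 1) - p j).re + e.im * (p (j + 1) - p j).im) /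
    ‖p (j + 1) - p j‖
  have he2 := Complex.re_sq_add_im_sq_eq e
  rw [he] at he2
  have hcs : ∀ j, c j ^ 2 + (planeCross e (p (j + 1) - p j) / ‖p (j + 1) - p j‖) ^ 2 = 1 := by
    intro j
    have hn := h.norm_pos j
    have hsq := Complex.re_sq_add_im_sq_eq (p (j + 1) - p j)
    simp only [c, planeCross_eq]
    generalize p (j + 1) - p j = w at *
    field_simp
    rw [← hsq]
    linear_combination (w.re ^ 2 + w.im ^ 2) * he2
  have hc1 : ∀ j, -1 ≤ c j ∧ c j ≤ 1 := by
    intro j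
    have := hcs j
    constructor <;> nlinarith [sq_nonneg (planeCross e (p (j + 1) - p j) / ‖p (j + 1) - p j‖)]
  have hgap : ∀ j, 0 ≤ planeCross e (p (j + 1) - p j) →
      0 ≤ planeCross e (p (j + 2) - p (j + 1)) → c (j + 1) ≤ c j - q ^ 2 / 2 := by
    intro j h1 h2
    have hn1 := h.norm_pos j
    have hn2 := h.norm_pos (j + 1)
    have hl1 := h.len j
    have hl2 := h.len (j + 1)
    have ht := h.turn j
    have k1 := hcs j
    have k2 := hcs (j + 1)
    simp only [c] at k1 k2 ⊢
    rw [show j + 1 + 1 = j + 2 by ring] at *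
    have := cos_gap_of_cross k1 k2 (by positivity) (by positivity) hq (by
      generalize p (j + 1) - p j = u at *
      generalize p (j + 2) - p (j + 1) = v at *
      have hid : (e.re * u.re + e.im * u.im) / ‖u‖ * (planeCross e v / ‖v‖) -
          planeCross e u / ‖u‖ * ((e.re * v.re + e.im * v.im) / ‖v‖) =
          planeCross u v / (‖u‖ * ‖v‖) := by
        simp only [planeCross_eq]
        field_simp
        linear_combination (u.re * v.im - u.im * v.re) * he2
      rw [hid, le_div_iff₀ (by positivity)]
      have : ‖u‖ * ‖v‖ ≤ A ^ 2 := by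
        rw [pow_two]; exact mul_le_mul hl1 hl2 hn2.le hA.le
      nlinarith)
    linarith
  have hrun : ∀ n : ℕ, (∀ l : ℕ, l ≤ n → 0 ≤ planeCross e (p (i + l + 1) - p (i + l))) →
      c (i + n) ≤ c i - n * (q ^ 2 / 2) := by
    intro n
    induction n with
    | zero => intro _; simp
    | succ n ih =>
      intro hall
      have h1 := ih fun l hl => hall l (by omega)
      have h2 := hgap (i + n) (hall n (by omega)) (by
        have := hall (n + 1) le_rfl
        push_cast at this
        rw [show i + (n + 1 : ℤ) + 1 = i + n + 2 by ring, ← add_assoc] at this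
        exact this)
      push_cast
      rw [← add_assoc]
      linarith
  have hex : ∃ n : ℕ, planeCross e (p (i + n + 1) - p (i + n)) < 0 := by
    by_contra hcon
    push Not at hcon
    obtain ⟨n, hn⟩ := exists_nat_gt (2 / (q ^ 2 / 2))
    rw [div_lt_iff₀ (by positivity)] at hn
    have := hrun n fun l _ => hcon l
    linarith [(hc1 i).2, (hc1 (i + n)).1]
  classical
  have hn := Nat.find_spec hex
  have hmin : ∀ m : ℕ, m < Nat.find hex → 0 ≤ planeCross e (p (i + m + 1) - p (i + m)) :=
    fun m hm => not_lt.1 (Nat.find_min hex hm)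
  set n := Nat.find hex
  obtain ⟨m, hm⟩ : ∃ m, n = m + 1 := by
    refine Nat.exists_eq_succ_of_ne_zero ?_
    intro h0
    rw [h0] at hn
    simp only [Nat.cast_zero, add_zero] at hn
    linarith
  have hmn : (m : ℝ) ≤ 4 / q ^ 2 := by
    have := hrun m fun l hl => hmin l (by omega)
    rw [le_div_iff₀ (by positivity)]
    linarith [(hc1 i).2, (hc1 (i + m)).1]
  have hclimb : ∀ l : ℕ, planeCross e (p (i + l) - p i) ≤ l * A := by
    intro l
    induction l with
    | zero => simp [planeCross_eq]
    | succ l ih =>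
      have h1 := (le_abs_self _).trans (abs_planeCross_le e (p (i + l + 1) - p (i + l)))
      have h2 := h.len (i + l)
      rw [he, one_mul] at h1
      have h3 : planeCross e (p (i + (l + 1 : ℕ)) - p i) =
          planeCross e (p (i + l) - p i) + planeCross e (p (i + l + 1) - p (i + l)) := by
        push_cast
        rw [← add_assoc]
        simp [planeCross_eq]; ring
      rw [h3]; push_cast; linarith
  refine ⟨i + n, hn, ?_, ?_⟩
  · refine (hclimb n).trans ?_
    rw [hm]; push_cast
    nlinarith
  · intro k
    have hup := hmin m (by omega)
    have e1 : i + (m : ℤ) + 1 = i + n := by rw [hm]; push_cast; ring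
    have e2 : i + (m : ℤ) + 2 = i + n + 1 := by rw [hm]; push_cast; ring
    have t := h.turn_pos (i + m)
    have l0 := h.left (i + m) k
    have l1 := h.left (i + n) k
    rw [e1, e2] at t
    rw [e1] at l0 hup
    have l0' : 0 ≤ planeCross (p (i + n) - p (i + m)) (p k - p (i + n)) := by
      refine le_of_le_of_eq l0 ?_
      simp [planeCross_eq]; ring
    generalize p (i + n + 1) - p (i + n) = v at *
    generalize p (i + n) - p (i + m) = u at *
    generalize p k - p (i + n) = w at *
    -- The local top is global: the polygon lies in the cone to the left of the last rising edge `u`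
    -- and the first falling edge `v`, and this identity makes every direction `w` in the cone
    -- descend.
    have hid : planeCross u v * planeCross e w =
        planeCross e v * planeCross u w - planeCross e u * planeCross v w := by
      simp only [planeCross_eq]; ring
    by_contra hcon
    push Not at hcon
    nlinarith [mul_pos t hcon, mul_nonneg hup l1]

/-- If the edge leaving `p i` falls, pass to the lowest corner: its outgoing edge rises, so a single
climb bounds the full height of the polygon. -/
theorem height_le (h : StrictPolygon p A q) {e : ℂ} (he : ‖e‖ = 1) (i k : ℤ) :
    planeCross e (p k - p i) ≤ (4 / q ^ 2 + 1) * A := by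
  have hadd : ∀ j, planeCross e (p k - p i) =
      planeCross e (p k - p j) + planeCross e (p j - p i) := by
    intro j; simp [planeCross_eq]; ring
  have hneg : ∀ w, planeCross (-e) w = - planeCross e w := by
    intro w; simp [planeCross_eq]; ring
  rcases le_or_gt 0 (planeCross e (p (i + 1) - p i)) with hi | hi
  · obtain ⟨j, -, h1, h2⟩ := h.exists_highest he hi
    linarith [hadd j, h2 k]
  · obtain ⟨j, h0, -, h2⟩ := h.exists_highest (e := -e) (i := i) (by simpa using he)
      (by rw [hneg]; linarith)
    rw [hneg] at h0
    obtain ⟨l, -, h3, h4⟩ := h.exists_highest he (i := j) (by linarith)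
    have h5 := h2 i
    rw [hneg] at h5
    have h6 : planeCross e (p i - p j) = - planeCross e (p j - p i) := by
      simp [planeCross_eq]; ring
    have h7 : planeCross e (p l - p i) =
      planeCross e (p l - p j) + planeCross e (p j - p i) := by simp [planeCross_eq]; ring
    linarith [hadd l, h4 k]

/-- The diameter bound. -/
theorem norm_sub_le (h : StrictPolygon p A q) {z w : ℂ} (hz : z ∈ convexHull ℝ (Set.range p))
    (hw : w ∈ convexHull ℝ (Set.range p)) : ‖z - w‖ ≤ (4 / q ^ 2 + 1) * A := by
  have hA := h.A_pos
  have hq := h.q_pos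
  rcases eq_or_ne z w with rfl | hne
  · simp; positivity
  have hv : 0 < ‖z - w‖ := norm_pos_iff.2 (sub_ne_zero.2 hne)
  -- With `e` perpendicular to `z - w`, the distance becomes a height difference, bounded by that of
  -- two corners.
  obtain ⟨e, he, hez⟩ : ∃ e : ℂ, ‖e‖ = 1 ∧ planeCross e (z - w) = ‖z - w‖ := by
    refine ⟨-Complex.I * ((z - w) / ‖z - w‖), ?_, ?_⟩
    · simp [hv.ne']
    · have hsq := Complex.re_sq_add_im_sq_eq (z - w)
      rw [planeCross_eq]
      simp only [Complex.mul_re, Complex.mul_im, Complex.neg_re, Complex.neg_im, Complex.I_re,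
        Complex.I_im, Complex.div_ofReal_re, Complex.div_ofReal_im]
      field_simp
      linear_combination hsq
  set R := (4 / q ^ 2 + 1) * A
  obtain ⟨i, hi⟩ := exists_corner_nonneg (e := e) hz
  obtain ⟨k, hk⟩ := exists_corner_nonneg (e := -e) hw
  have := h.height_le he k i
  simp only [planeCross_eq, Complex.sub_re, Complex.sub_im, Complex.neg_re, Complex.neg_im]
    at hi hk hez this
  linarith

/-- The barycentric coordinates of `z` are the ratios of the three signed areas to `d`. -/
theorem mem_of_triangle {S : Set ℂ} {a b c z : ℂ} (hS : Convex ℝ S) (ha : a ∈ S) (hb : b ∈ S)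
    (hc : c ∈ S) (habc : 0 < planeCross (b - a) (c - b)) (h1 : 0 ≤ planeCross (b - a) (z - a))
    (h2 : 0 ≤ planeCross (c - b) (z - b)) (h3 : 0 ≤ planeCross (a - c) (z - c)) : z ∈ S := by
  set d := planeCross (b - a) (c - b) with hd
  have hsum : planeCross (c - b) (z - b) + planeCross (a - c) (z - c)
      + planeCross (b - a) (z - a) = d := by
    rw [hd]; simp [planeCross_eq]; ring
  have key := hS.sum_mem (t := Finset.univ) (w := ![planeCross (c - b) (z - b) / d,
    planeCross (a - c) (z - c) / d, planeCross (b - a) (z - a) / d]) (z := ![a, b, c])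
    (by intro i _; fin_cases i <;> simp <;> positivity)
    (by rw [Fin.sum_univ_three]; simp; field_simp; exact hsum)
    (by intro i _; fin_cases i <;> simpa)
  rw [Fin.sum_univ_three] at key
  convert key using 1
  simp only [Matrix.cons_val_zero, Matrix.cons_val_one, Matrix.cons_val]
  apply Complex.ext
  · simp only [Complex.add_re, Complex.smul_re, smul_eq_mul]
    field_simp
    rw [hd]; simp [planeCross_eq]; ring
  · simp only [Complex.add_im, Complex.smul_im, smul_eq_mul]
    field_simp
    rw [hd]; simp [planeCross_eq]; ring

theorem corner_mem (p : ℤ → ℂ) (k : ℤ) : p k ∈ convexHull ℝ (Set.range p) :=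
  subset_convexHull ℝ _ ⟨k, rfl⟩

/-- The polygon contains a segment of definite length orthogonal to an edge at its midpoint. -/
theorem normal_mem (h : StrictPolygon p A q) (k : ℤ) {n : ℂ} (hn : ‖n‖ = 1)
    (hkn : 0 ≤ planeCross (p (k + 1) - p k) n) :
    p k + (1 / 2 : ℝ) • (p (k + 1) - p k) + (q * A / 4) • n ∈ convexHull ℝ (Set.range p) := by
  have hA := h.A_pos
  have hq := h.q_pos
  have ht := h.turn k
  have l1 := h.len k
  have l2 := h.len (k + 1)
  rw [show k + 1 + 1 = k + 2 by ring] at l2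
  have c1 := (abs_planeCross_le (p (k + 1) - p k) n)
  have c2 := (abs_planeCross_le (p (k + 2) - p (k + 1)) n)
  rw [hn, mul_one, abs_le] at c1 c2
  -- The triangle of three successive corners suffices. At the midpoint of the edge the signed areas
  -- against the two other sides are at least `q * A ^ 2 / 2`; the displacement costs at most `q * A
  -- / 4` times `A`, respectively `2 * A`, whence the factor `1 / 4`.
  refine mem_of_triangle (convex_convexHull ℝ _) (corner_mem p k) (corner_mem p (k + 1))
    (corner_mem p (k + 2)) (h.turn_pos k) ?_ ?_ ?_
  · have : planeCross (p (k + 1) - p k)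
        (p k + (1 / 2 : ℝ) • (p (k + 1) - p k) + (q * A / 4) • n - p k) =
        (q * A / 4) * planeCross (p (k + 1) - p k) n := by simp [planeCross_eq]; ring
    rw [this]; positivity
  · have : planeCross (p (k + 2) - p (k + 1))
        (p k + (1 / 2 : ℝ) • (p (k + 1) - p k) + (q * A / 4) • n - p (k + 1)) =
        planeCross (p (k + 1) - p k) (p (k + 2) - p (k + 1)) / 2 +
        (q * A / 4) * planeCross (p (k + 2) - p (k + 1)) n := by simp [planeCross_eq]; ring
    rw [this]
    have : 0 < q * A := by positivity
    nlinarith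
  · have : planeCross (p k - p (k + 2))
        (p k + (1 / 2 : ℝ) • (p (k + 1) - p k) + (q * A / 4) • n - p (k + 2)) =
        planeCross (p (k + 1) - p k) (p (k + 2) - p (k + 1)) / 2 -
        (q * A / 4) * (planeCross (p (k + 1) - p k) n + planeCross (p (k + 2) - p (k + 1)) n) := by
      simp [planeCross_eq]; ring
    rw [this]
    have : 0 < q * A := by positivity
    nlinarith

/-- The polygon fills the inner side of an edge near its midpoint. -/
theorem eventually_interior (h : StrictPolygon p A q) (k : ℤ) {w : ℂ}
    (hw : 0 < planeCross (p (k + 1) - p k) w) :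
    ∀ᶠ s : ℝ in nhdsWithin 0 (Set.Ioi 0),
      p k + (1 / 2 : ℝ) • (p (k + 1) - p k) + s • w ∈ interior (convexHull ℝ (Set.range p)) := by
  set a := p k
  set b := p (k + 1)
  set c := p (k + 2)
  have ht := h.turn_pos k
  have hcont : ∀ u v : ℂ, Continuous fun z : ℂ => planeCross u (z - v) := by
    intro u v; unfold planeCross; fun_prop
  let U : Set ℂ := {z | 0 < planeCross (b - a) (z - a)} ∩ {z | 0 < planeCross (c - b) (z - b)} ∩
    {z | 0 < planeCross (a - c) (z - c)}
  have hU : IsOpen U := ((isOpen_lt continuous_const (hcont _ _)).inter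
    (isOpen_lt continuous_const (hcont _ _))).inter (isOpen_lt continuous_const (hcont _ _))
  have hUi : U ⊆ interior (convexHull ℝ (Set.range p)) := by
    refine interior_maximal ?_ hU
    rintro z ⟨⟨h1, h2⟩, h3⟩
    exact mem_of_triangle (convex_convexHull ℝ _) (corner_mem p k) (corner_mem p (k + 1))
      (corner_mem p (k + 2)) ht h1.le h2.le h3.le
  have hcs : ∀ u v : ℂ, Continuous fun s : ℝ =>
      planeCross u (a + (1 / 2 : ℝ) • (b - a) + s • w - v) := by
    intro u v; exact (hcont u v).comp (by fun_prop)
  have e2 : ∀ᶠ s : ℝ in nhdsWithin 0 (Set.Ioi 0),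
      0 < planeCross (c - b) (a + (1 / 2 : ℝ) • (b - a) + s • w - b) := by
    refine ((hcs (c - b) b).tendsto 0).eventually_const_lt ?_ |>.filter_mono nhdsWithin_le_nhds
    have : planeCross (c - b) (a + (1 / 2 : ℝ) • (b - a) + (0 : ℝ) • w - b) =
      planeCross (b - a) (c - b) / 2 := by simp [planeCross_eq]; ring
    rw [this]; exact half_pos ht
  have e3 : ∀ᶠ s : ℝ in nhdsWithin 0 (Set.Ioi 0),
      0 < planeCross (a - c) (a + (1 / 2 : ℝ) • (b - a) + s • w - c) := by
    refine ((hcs (a - c) c).tendsto 0).eventually_const_lt ?_ |>.filter_mono nhdsWithin_le_nhds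
    have : planeCross (a - c) (a + (1 / 2 : ℝ) • (b - a) + (0 : ℝ) • w - c) =
      planeCross (b - a) (c - b) / 2 := by simp [planeCross_eq]; ring
    rw [this]; exact half_pos ht
  filter_upwards [e2, e3, self_mem_nhdsWithin] with s h2 h3 hs
  refine hUi ⟨⟨?_, h2⟩, h3⟩
  have : planeCross (b - a) (a + (1 / 2 : ℝ) • (b - a) + s • w - a) = s * planeCross (b - a) w := by
    simp [planeCross_eq]; ring
  change 0 < planeCross (b - a) _
  rw [this]
  exact mul_pos hs hw

end StrictPolygon

/-! ### Faces of a rigid drawing and adjacency across an edge. -/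

namespace ColoredDrawing

variable {V F : Type*} {T : ColoredDrawing V F}

theorem pt_mem_face (T : ColoredDrawing V F) (f : F) (i : ℤ) : T.pt f i ∈ T.face f :=
  subset_convexHull ℝ _ ⟨i, rfl⟩

theorem convex_face (T : ColoredDrawing V F) (f : F) : Convex ℝ (T.face f) :=
  convex_convexHull ℝ _

theorem IsProper.isClosed_face (hP : T.IsProper) (f : F) : IsClosed (T.face f) := by
  refine Set.Finite.isClosed_convexHull ℝ ?_
  refine ((Finset.range (T.size f)).finite_toSet.image fun n : ℕ => T.pt f n).subset ?_
  rintro _ ⟨i, rfl⟩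
  have hN : (0 : ℤ) < T.size f := by have := hP.three_le_size f; omega
  refine ⟨(i % T.size f).toNat, ?_, ?_⟩
  · have := Int.emod_lt_of_pos i hN
    have := Int.emod_nonneg i hN.ne'
    simp; omega
  · have h0 := Int.emod_nonneg i hN.ne'
    have : T.corner f (i % T.size f) = T.corner f i :=
      (hP.corner_eq_iff f _ _).2 (Int.mod_modEq i _)
    simp only [pt, Int.toNat_of_nonneg h0, this]

/-- With `A = m * C`, the area spanned at a corner is at least `sin ε * (m / C) ^ 2 = (sin ε / C ^
4) * A ^ 2`. -/
theorem strictPolygon_of_rigid (hP : T.IsProper) {S : Set ℂ} {m C ε : ℝ} (hm : 0 < m) (hC : 0 < C)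
    (hε : 0 < ε) (hR : T.RigidOn S m C ε) {f : F} (hf : (T.face f ∩ S).Nonempty) :
    StrictPolygon (T.pt f) (m * C) (Real.sin ε / C ^ 4) := by
  have hRf := hR f hf
  have hεπ : ε < Real.pi := by
    have := (hRf 0).2.2
    linarith
  have hsin : 0 < Real.sin ε := Real.sin_pos_of_pos_of_lt_pi hε hεπ
  have hleft : ∀ i j, 0 ≤ planeCross (T.pt f (i + 1) - T.pt f i) (T.pt f j - T.pt f i) :=
    hP.convex_left f
  refine ⟨by positivity, by positivity, ⟨T.size f, by have := hP.three_le_size f; omega, ?_⟩,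
    hleft, ?_, ?_⟩
  · intro i
    have : T.corner f (i + T.size f) = T.corner f i := by
      rw [hP.corner_eq_iff]; exact Int.add_modEq_right
    simp only [pt, this]
  · intro i
    obtain ⟨h1, -, -, -⟩ := hRf i
    obtain ⟨h2, -, h3, h4⟩ := hRf (i + 1)
    rw [angle, EuclideanGeometry.angle, show i + 1 - 1 = i by ring] at h3 h4
    rw [show i + 1 + 1 = i + 2 by ring] at h2 h3 h4
    have hl := hleft i (i + 2)
    rw [dist_eq_norm] at h1 h2
    simp only [vsub_eq_sub] at h3 h4
    rw [← neg_sub (T.pt f (i + 1)) (T.pt f i)] at h3 h4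
    have hl' : planeCross (T.pt f (i + 1) - T.pt f i) (T.pt f (i + 2) - T.pt f i) =
        planeCross (T.pt f (i + 1) - T.pt f i) (T.pt f (i + 2) - T.pt f (i + 1)) := by
      simp [planeCross_eq]; ring
    rw [hl'] at hl
    generalize T.pt f (i + 1) - T.pt f i = u at *
    generalize T.pt f (i + 2) - T.pt f (i + 1) = v at *
    have hs := InnerProductGeometry.sin_angle_mul_norm_mul_norm (-u) v
    have hsq : inner ℝ (-u) (-u) * inner ℝ v v - inner ℝ (-u) v * inner ℝ (-u) v =
        planeCross u v ^ 2 := by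
      rw [real_inner_self_eq_norm_sq, real_inner_self_eq_norm_sq, norm_neg,
        ← Complex.re_sq_add_im_sq_eq, ← Complex.re_sq_add_im_sq_eq]
      simp [Complex.inner, planeCross_eq]; ring
    rw [hsq, Real.sqrt_sq hl, norm_neg] at hs
    have hsinle : Real.sin ε ≤ Real.sin (InnerProductGeometry.angle (-u) v) := by
      set t := InnerProductGeometry.angle (-u) v
      rcases le_or_gt t (Real.pi / 2) with ht | ht
      · exact Real.sin_le_sin_of_le_of_le_pi_div_two (by linarith) ht h3.le
      · rw [← Real.sin_pi_sub t]
        exact Real.sin_le_sin_of_le_of_le_pi_div_two (by linarith) (by linarith) (by linarith)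
    have hprod : m / C * (m / C) ≤ ‖u‖ * ‖v‖ := by gcongr
    calc Real.sin ε / C ^ 4 * (m * C) ^ 2 = Real.sin ε * (m / C * (m / C)) := by
          field_simp
      _ ≤ Real.sin (InnerProductGeometry.angle (-u) v) * (‖u‖ * ‖v‖) :=
          mul_le_mul hsinle hprod (by positivity) (hsin.le.trans hsinle)
      _ = _ := hs
  · intro i
    rw [← dist_eq_norm]
    exact (hRf i).2.1

/-- A path that stays in the region is frequently in one and the same face. -/
theorem exists_frequently_mem_face [Finite F] {γ : ℝ → ℂ} {l : Filter ℝ} [l.NeBot]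
    (h : ∀ᶠ t in l, γ t ∈ T.region) : ∃ g, ∃ᶠ t in l, γ t ∈ T.face g := by
  by_contra hcon
  push Not at hcon
  have hcon' : ∀ g, ∀ᶠ t in l, γ t ∉ T.face g := hcon
  obtain ⟨t, h1, h2⟩ := (h.and (Filter.eventually_all.2 hcon')).exists
  obtain ⟨g, hg⟩ := Set.mem_iUnion.1 h1
  exact h2 g hg

/-- For `d = ±a ≠ 0` this is an open half-plane with an open half-line of its boundary. It serves to
find, on a supporting line of a polygon, corners on either side of a given point of the polygon. -/
theorem convex_lexHalfPlane (a d b c : ℂ) :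
    Convex ℝ {z : ℂ | planeCross a (z - b) < 0 ∨ (planeCross a (z - b) = 0 ∧
      d.re * (z - c).re + d.im * (z - c).im < 0)} := by
  intro x hx y hy s t hs ht hst
  have e1 : planeCross a (s • x + t • y - b) =
      s * planeCross a (x - b) + t * planeCross a (y - b) := by
    obtain rfl : t = 1 - s := by linarith
    simp [planeCross_eq]; ring
  have e2 : d.re * (s • x + t • y - c).re + d.im * (s • x + t • y - c).im =
      s * (d.re * (x - c).re + d.im * (x - c).im) +
      t * (d.re * (y - c).re + d.im * (y - c).im) := by
    obtain rfl : t = 1 - s := by linarith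
    simp; ring
  simp only [Set.mem_ofPred_eq] at hx hy ⊢
  rw [e1, e2]
  rcases eq_or_lt_of_le hs with h0 | h0
  · obtain rfl : t = 1 := by linarith
    rw [← h0]
    simpa using hy
  rcases eq_or_lt_of_le ht with h1 | h1
  · obtain rfl : s = 1 := by linarith
    rw [← h1]
    simpa using hx
  rcases hx with hx | ⟨hx, hx'⟩ <;> rcases hy with hy | ⟨hy, hy'⟩
  · left; nlinarith
  · left; rw [hy]; nlinarith
  · left; rw [hx]; nlinarith
  · right; rw [hx, hy]; exact ⟨by ring, by nlinarith⟩

/-- Across an edge whose midpoint is an interior point of the region there is another face which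
contains this edge. -/
theorem exists_face_across [Finite F] (hP : T.IsProper) {f : F} {A q : ℝ}
    (hf : StrictPolygon (T.pt f) A q) (k : ℤ)
    (hint : T.pt f k + (1 / 2 : ℝ) • (T.pt f (k + 1) - T.pt f k) ∈ interior T.region) :
    ∃ g, T.pt f k ∈ T.face g ∧ T.pt f (k + 1) ∈ T.face g ∧
      ∀ z ∈ T.face g, planeCross (T.pt f (k + 1) - T.pt f k) (z - T.pt f k) ≤ 0 := by
  set a := T.pt f k with ha
  set b := T.pt f (k + 1) with hb
  set m := a + (1 / 2 : ℝ) • (b - a) with hm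
  have hEpos : 0 < (b - a).re ^ 2 + (b - a).im ^ 2 := by
    rw [Complex.re_sq_add_im_sq_eq]; exact pow_pos (hf.norm_pos k) 2
  -- Leave `f` through the midpoint `m` along the outer normal; a face met for arbitrarily small `t`
  -- contains `m` because it is closed.
  have hcont : Continuous fun t : ℝ => m - t • (Complex.I * (b - a)) := by fun_prop
  have hlim : Filter.Tendsto (fun t : ℝ => m - t • (Complex.I * (b - a)))
      (nhdsWithin 0 (Set.Ioi 0)) (nhds m) := by
    have := hcont.tendsto 0
    simp only [zero_smul, sub_zero] at this
    exact this.mono_left nhdsWithin_le_nhds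
  obtain ⟨g, hg⟩ := exists_frequently_mem_face
    (hlim.eventually (mem_interior_iff_mem_nhds.1 hint))
  have hmg : m ∈ T.face g := (hP.isClosed_face g).mem_of_frequently_of_tendsto hg hlim
  have hgf : g ≠ f := by
    rintro rfl
    obtain ⟨t, ht1, ht2⟩ := (hg.and_eventually self_mem_nhdsWithin).exists
    have := hf.left_of_mem k ht1
    have e : planeCross (T.pt g (k + 1) - T.pt g k) (m - t • (Complex.I * (b - a)) - T.pt g k) =
        - t * ((b - a).re ^ 2 + (b - a).im ^ 2) := by
      rw [← ha, ← hb, hm]; simp [planeCross_eq]; ring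
    rw [e] at this
    have ht2' : (0 : ℝ) < t := ht2
    nlinarith
  -- Otherwise the segment from `m` to `z` would enter the interior of `f`, and as `g` is the
  -- closure of its interior, the two interiors would meet.
  have hside : ∀ z ∈ T.face g, planeCross (b - a) (z - a) ≤ 0 := by
    intro z hz
    by_contra hcon
    push Not at hcon
    have hzm : 0 < planeCross (b - a) (z - m) := by
      refine lt_of_lt_of_eq hcon ?_
      rw [hm]; simp [planeCross_eq]; ring
    have h1 := hf.eventually_interior k hzm
    have h2 : ∀ᶠ s : ℝ in nhdsWithin 0 (Set.Ioi 0), s ≤ 1 :=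
      Filter.Eventually.filter_mono nhdsWithin_le_nhds (eventually_le_nhds one_pos)
    obtain ⟨s, ⟨h1, h2⟩, h3⟩ := ((h1.and h2).and self_mem_nhdsWithin).exists
    have h3' : (0 : ℝ) < s := h3
    have h4 : m + s • (z - m) ∈ T.face g :=
      (T.convex_face g).add_smul_sub_mem hmg hz ⟨h3'.le, h2⟩
    have h5 : T.face g ⊆ closure (interior (T.face g)) := by
      rw [(T.convex_face g).closure_interior_eq_closure_of_nonempty_interior
        (hP.interior_nonempty g)]
      exact subset_closure
    obtain ⟨x, hx1, hx2⟩ := mem_closure_iff.1 (h5 h4) _ isOpen_interior h1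
    exact Set.disjoint_left.1 (hP.interior_disjoint f g hgf.symm) hx1 hx2
  have hfk : ∀ j, ∀ l : ℝ, 0 < l → l < 1 → T.pt f j ≠ a + l • (b - a) := by
    intro j l h0 h1 hj
    have := hf.corner_not_between j (T.pt_mem_face f k) (T.pt_mem_face f (k + 1)) h0 h1 hj
    have hn := hf.norm_pos k
    rw [this] at hn
    simp at hn
  -- The line through `a` and `b` supports `g` at `m`, so it carries corners of `g` on both sides of
  -- `m`. None lies strictly between `a` and `b`, since it would be a corner of `f`; by convexity
  -- `g` then contains `a` and `b`.
  have hcorner : ∀ c : ℂ, ∃ l : ℝ, a + l • (b - a) ∈ T.face g ∧ (l ≤ 0 ∨ 1 ≤ l) ∧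
      0 ≤ (l - 1 / 2) * (c.re * (b - a).re + c.im * (b - a).im) := by
    intro c
    obtain ⟨i, hi1, hi2⟩ : ∃ i, planeCross (b - a) (T.pt g i - a) = 0 ∧
        0 ≤ c.re * (T.pt g i - m).re + c.im * (T.pt g i - m).im := by
      by_contra hcon
      push Not at hcon
      have := convexHull_min (s := Set.range (T.pt g))
        (t := {z : ℂ | planeCross (b - a) (z - a) < 0 ∨ (planeCross (b - a) (z - a) = 0 ∧
          c.re * (z - m).re + c.im * (z - m).im < 0)}) ?_ (convex_lexHalfPlane (b - a) c a m) hmg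
      · have h0 : planeCross (b - a) (m - a) = 0 := by rw [hm]; simp [planeCross_eq]; ring
        simp [h0] at this
      · rintro _ ⟨i, rfl⟩
        rcases lt_or_eq_of_le (hside _ (T.pt_mem_face g i)) with h | h
        · exact Or.inl h
        · exact Or.inr ⟨h, hcon i h⟩
    obtain ⟨l, hl⟩ : ∃ l : ℝ, T.pt g i = a + l • (b - a) := by
      rw [planeCross_eq] at hi1
      refine ⟨((T.pt g i - a).re * (b - a).re + (T.pt g i - a).im * (b - a).im) /
        ((b - a).re ^ 2 + (b - a).im ^ 2), ?_⟩
      generalize T.pt g i = z at *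
      rw [← sub_eq_iff_eq_add']
      generalize b - a = u at *
      generalize z - a = w at *
      apply Complex.ext
      · simp only [Complex.smul_re, smul_eq_mul]
        field_simp
        linear_combination (- u.im) * hi1
      · simp only [Complex.smul_im, smul_eq_mul]
        field_simp
        linear_combination u.re * hi1
    refine ⟨l, hl ▸ T.pt_mem_face g i, ?_, ?_⟩
    · by_contra hcon
      push Not at hcon
      have hmem : T.pos (T.corner g i) ∈ T.face f := by
        change T.pt g i ∈ _
        rw [hl]
        exact (T.convex_face f).add_smul_sub_mem (T.pt_mem_face f k) (T.pt_mem_face f (k + 1))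
          ⟨hcon.1.le, hcon.2.le⟩
      obtain ⟨j, hj⟩ := hP.corner_of_mem _ _ hmem
      refine hfk j l hcon.1 hcon.2 ?_
      rw [← hl, pt, pt, hj]
    · rw [hl, hm] at hi2
      refine le_of_le_of_eq hi2 ?_
      simp; ring
  refine ⟨g, ?_, ?_, hside⟩
  · obtain ⟨l, h1, h2, h3⟩ := hcorner (-(b - a))
    have h4 : l ≤ 0 := by
      rcases h2 with h2 | h2
      · exact h2
      · simp only [Complex.neg_re, Complex.neg_im] at h3; nlinarith
    have := (T.convex_face g).add_smul_sub_mem hmg h1 (t := (1 / 2) / (1 / 2 - l))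
      ⟨div_nonneg (by norm_num) (by linarith), by rw [div_le_one (by linarith)]; linarith⟩
    convert this using 1
    have h5 : (1 / 2 - l) ≠ 0 := by linarith
    have h6 : a + l • (b - a) - m = (-(1 / 2 - l)) • (b - a) := by
      rw [hm]; simp only [neg_smul, sub_smul]; ring
    rw [h6, smul_smul, show 1 / 2 / (1 / 2 - l) * -(1 / 2 - l) = -(1 / 2) by
        rw [mul_neg, div_mul_cancel₀ _ h5], hm,
      neg_smul]
    ring
  · obtain ⟨l, h1, h2, h3⟩ := hcorner (b - a)
    have h4 : 1 ≤ l := by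
      rcases h2 with h2 | h2
      · nlinarith
      · exact h2
    have := (T.convex_face g).add_smul_sub_mem hmg h1 (t := (1 / 2) / (l - 1 / 2))
      ⟨div_nonneg (by norm_num) (by linarith), by rw [div_le_one (by linarith)]; linarith⟩
    convert this using 1
    have h5 : (l - 1 / 2) ≠ 0 := by linarith
    have h6 : a + l • (b - a) - m = (l - 1 / 2) • (b - a) := by
      rw [hm]; simp only [sub_smul]; ring
    rw [h6, smul_smul, show 1 / 2 / (l - 1 / 2) * (l - 1 / 2) = 1 / 2 from
      div_mul_cancel₀ _ h5, hm,
      add_assoc, ← add_smul]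
    norm_num

/-- A strictly convex face lying across an edge has this edge, reversed. -/
theorem exists_reversed_edge (hP : T.IsProper) {g : F} {A q : ℝ}
    (hg : StrictPolygon (T.pt g) A q) {u v : V} (huv : u ≠ v) (hu : T.pos u ∈ T.face g)
    (hv : T.pos v ∈ T.face g)
    (hside : ∀ z ∈ T.face g, planeCross (T.pos v - T.pos u) (z - T.pos u) ≤ 0) :
    ∃ i, T.corner g i = v ∧ T.corner g (i + 1) = u := by
  obtain ⟨i, hi⟩ := hP.corner_of_mem _ _ hv
  obtain ⟨j, hj⟩ := hP.corner_of_mem _ _ hu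
  have hpi : T.pt g i = T.pos v := by rw [pt, hi]
  have hpj : T.pt g j = T.pos u := by rw [pt, hj]
  have := hg.next_corner_eq (i := i) (j := j)
    (by rw [hpi, hpj]; exact fun h => huv (hP.pos_injective h).symm) (by
      intro k
      have := hside _ (T.pt_mem_face g k)
      rw [hpi, hpj]
      simp only [planeCross_eq, Complex.sub_re, Complex.sub_im] at this ⊢
      linarith)
  exact ⟨i, hi, hP.pos_injective (this.trans hpj)⟩

end ColoredDrawing

/-! ### Origami maps: non-expansion and folding along edges. -/

namespace ColoredDrawing

variable {V F : Type*} {T : ColoredDrawing V F} {O : ℂ → ℂ}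

theorem IsOrigamiMap.norm_sub (hO : T.IsOrigamiMap O) {f : F} {z z' : ℂ} (hz : z ∈ T.face f)
    (hz' : z' ∈ T.face f) : ‖O z - O z'‖ = ‖z - z'‖ := by
  obtain ⟨ζ, h1, -, h3, h4⟩ := hO
  cases hf : T.black f with
  | false => rw [h3 f hf z hz z' hz', norm_mul, h1, one_mul]
  | true => rw [h4 f hf z hz z' hz', norm_mul, Complex.norm_conj, Complex.norm_conj, h1, one_mul]

theorem IsOrigamiMap.continuousOn_region [Finite F] (hP : T.IsProper) (hO : T.IsOrigamiMap O) :
    ContinuousOn O T.region := by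
  refine (locallyFinite_of_finite T.face).continuousOn_iUnion hP.isClosed_face fun f => ?_
  refine LipschitzOnWith.continuousOn (K := 1) (LipschitzOnWith.of_dist_le_mul fun z hz z' hz' => ?_)
  rw [dist_eq_norm, dist_eq_norm, hO.norm_sub hz hz']
  simp

/-- Origami maps do not increase the length of segments. -/
theorem IsOrigamiMap.norm_sub_le [Finite F] (hP : T.IsProper) (hO : T.IsOrigamiMap O) {a b : ℂ}
    (hab : segment ℝ a b ⊆ T.region) : ‖O b - O a‖ ≤ ‖b - a‖ := by
  have hγ : Continuous fun t : ℝ => a + t • (b - a) := by fun_prop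
  have hreg : ∀ t ∈ Set.Icc (0 : ℝ) 1, a + t • (b - a) ∈ T.region := by
    intro t ht
    apply hab
    rw [segment_eq_image']
    exact ⟨t, ht, rfl⟩
  have hcont : ContinuousOn (fun t : ℝ => ‖O (a + t • (b - a)) - O a‖) (Set.Icc 0 1) :=
    ((hO.continuousOn_region hP).comp hγ.continuousOn hreg |>.sub continuousOn_const).norm
  -- Continuous induction along the segment: beyond each parameter `x` there are arbitrarily close
  -- points in a common face with the point at `x`, and `O` is isometric there.
  have hsub : Set.Icc (0 : ℝ) 1 ⊆ {t : ℝ | ‖O (a + t • (b - a)) - O a‖ ≤ t * ‖b - a‖} := by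
    refine IsClosed.Icc_subset_of_forall_exists_gt ?_ (by simp) ?_
    · rw [Set.inter_comm]
      exact isClosed_Icc.isClosed_le hcont (by fun_prop)
    · rintro x ⟨hx, hx0, hx1⟩ y hy
      have hev : ∀ᶠ t in nhdsWithin x (Set.Ioi x), t ∈ Set.Ioc x (min y 1) :=
        Ioc_mem_nhdsGT (lt_min hy hx1)
      obtain ⟨g, hg⟩ := exists_frequently_mem_face (T := T) (γ := fun t : ℝ => a + t • (b - a))
        (hev.mono fun t ht =>
          hreg t ⟨hx0.trans ht.1.le, ht.2.trans (min_le_right _ _)⟩)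
      have hxg : a + x • (b - a) ∈ T.face g :=
        (hP.isClosed_face g).mem_of_frequently_of_tendsto hg
          ((hγ.tendsto x).mono_left nhdsWithin_le_nhds)
      obtain ⟨t, htg, ht⟩ := (hg.and_eventually hev).exists
      refine ⟨t, ?_, ht.1, ht.2.trans (min_le_left _ _)⟩
      have hx' : ‖O (a + x • (b - a)) - O a‖ ≤ x * ‖b - a‖ := hx
      change ‖O (a + t • (b - a)) - O a‖ ≤ t * ‖b - a‖
      have h1 := hO.norm_sub htg hxg
      have h2 : a + t • (b - a) - (a + x • (b - a)) = (t - x) • (b - a) := by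
        rw [sub_smul]; ring
      rw [h2, norm_smul, Real.norm_of_nonneg (by linarith [ht.1])] at h1
      have h3 := norm_sub_le_norm_sub_add_norm_sub (O (a + t • (b - a))) (O (a + x • (b - a))) (O a)
      linarith
  simpa using hsub ⟨zero_le_one, le_rfl⟩

/-- The origami map identifies mirror images with respect to a common edge of two faces. -/
theorem IsOrigamiMap.eq_of_mirror_white (hO : T.IsOrigamiMap O) {w b : F}
    (hw : T.black w = false) (hb : T.black b = true) {u v m : ℂ} {s : ℝ}
    (huw : u ∈ T.face w) (hvw : v ∈ T.face w) (hmw : m ∈ T.face w)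
    (hub : u ∈ T.face b) (hvb : v ∈ T.face b) (hmb : m ∈ T.face b)
    (hxw : m + s • (Complex.I * (v - u)) ∈ T.face w)
    (hxb : m - s • (Complex.I * (v - u)) ∈ T.face b) :
    O (m + s • (Complex.I * (v - u))) = O (m - s • (Complex.I * (v - u))) := by
  obtain ⟨ζ, -, -, h3, h4⟩ := hO
  have e1 := h3 w hw v hvw u huw
  -- Comparing the increment along the edge in both faces gives `ζ w * (v - u) = conj (ζ b) * conj
  -- (v - u)`; conjugation turns the opposite normal displacements into the same image.
  have e2 := h4 b hb v hvb u hub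
  have e3 := h3 w hw _ hxw m hmw
  have e4 := h4 b hb _ hxb m hmb
  have e5 : (starRingEnd ℂ) (m - s • (Complex.I * (v - u)) - m) =
      s * Complex.I * (starRingEnd ℂ) (v - u) := by
    simp; ring
  have e6 : m + s • (Complex.I * (v - u)) - m = s * Complex.I * (v - u) := by
    simp; ring
  rw [e5] at e4
  rw [e6] at e3
  linear_combination e3 - e4 + s * Complex.I * (e2 - e1)

theorem IsOrigamiMap.eq_of_mirror (hO : T.IsOrigamiMap O) {f g : F}
    (hfg : T.black f ≠ T.black g) {u v m : ℂ} {s : ℝ}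
    (huf : u ∈ T.face f) (hvf : v ∈ T.face f) (hmf : m ∈ T.face f)
    (hug : u ∈ T.face g) (hvg : v ∈ T.face g) (hmg : m ∈ T.face g)
    (hxf : m + s • (Complex.I * (v - u)) ∈ T.face f)
    (hxg : m - s • (Complex.I * (v - u)) ∈ T.face g) :
    O (m + s • (Complex.I * (v - u))) = O (m - s • (Complex.I * (v - u))) := by
  cases hf : T.black f <;> cases hg : T.black g
  · exact absurd (hf.trans hg.symm) hfg
  · exact hO.eq_of_mirror_white hf hg huf hvf hmf hug hvg hmg hxf hxg
  · have := hO.eq_of_mirror_white hg hf (s := -s) hug hvg hmg huf hvf hmf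
      (by rwa [neg_smul, ← sub_eq_add_neg]) (by rwa [neg_smul, sub_neg_eq_add])
    rw [neg_smul, sub_neg_eq_add, ← sub_eq_add_neg] at this
    exact this.symm
  · exact absurd (hf.trans hg.symm) hfg

end ColoredDrawing

/-! ### The gain from one fold. -/

/-- This is `√(x ^ 2 + y ^ 2) ≤ x + y ^ 2 / (2 x)`: a lateral deviation lengthens a vector only to
second order. -/
theorem norm_le_of_dot {e w : ℂ} {r d : ℝ} (he : ‖e‖ = 1) (hd : 0 < d)
    (hw : d ≤ e.re * w.re + e.im * w.im) (hr : |planeCross e w| ≤ r) :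
    ‖w‖ ≤ e.re * w.re + e.im * w.im + r ^ 2 / (2 * d) := by
  have he2 := Complex.re_sq_add_im_sq_eq e
  rw [he] at he2
  have hr0 : 0 ≤ r := (abs_nonneg _).trans hr
  have h1 : ‖w‖ ^ 2 = (e.re * w.re + e.im * w.im) ^ 2 + planeCross e w ^ 2 := by
    rw [← Complex.re_sq_add_im_sq_eq, planeCross_eq]
    linear_combination (-(w.re ^ 2 + w.im ^ 2)) * he2
  have h2 : planeCross e w ^ 2 ≤ r ^ 2 := sq_le_sq' (by linarith [(abs_le.1 hr).1]) (abs_le.1 hr).2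
  set x := e.re * w.re + e.im * w.im
  have h3 : r ^ 2 = 2 * d * (r ^ 2 / (2 * d)) := by field_simp
  have h4 : 0 ≤ r ^ 2 / (2 * d) := by positivity
  set y := r ^ 2 / (2 * d)
  refine abs_le_of_sq_le_sq' ?_ (by linarith) |>.2
  nlinarith

/-- A detour through two points close to the midpoint of a long segment is shorter than the
segment, if one is allowed to jump forward from the first point to the second one. -/
theorem detour_le {e c x x' : ℂ} {H R g : ℝ} (he : ‖e‖ = 1) (hHR : R < H) (hx : ‖x - c‖ ≤ R)
    (hx' : ‖x' - c‖ ≤ R) (hg : 2 * g ≤ e.re * (x' - x).re + e.im * (x' - x).im)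
    (hR : R ^ 2 / (H - R) ≤ g) :
    ‖x - (c - H • e)‖ + ‖(c + H • e) - x'‖ ≤ 2 * H - g := by
  have he2 := Complex.re_sq_add_im_sq_eq e
  rw [he] at he2
  have hdot : ∀ w : ℂ, |e.re * w.re + e.im * w.im| ≤ ‖w‖ := by
    intro w
    have := Complex.abs_re_le_norm ((starRingEnd ℂ) e * w)
    simpa [Complex.mul_re, he] using this
  have d1 : e.re * (x - (c - H • e)).re + e.im * (x - (c - H • e)).im =
      e.re * (x - c).re + e.im * (x - c).im + H := by
    simp; linear_combination H * he2
  have d2 : e.re * (c + H • e - x').re + e.im * (c + H • e - x').im =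
      H - (e.re * (x' - c).re + e.im * (x' - c).im) := by
    simp; linear_combination H * he2
  have c1 : planeCross e (x - (c - H • e)) = planeCross e (x - c) := by
    simp [planeCross_eq]; ring
  have c2 : planeCross e (c + H • e - x') = - planeCross e (x' - c) := by
    simp [planeCross_eq]; ring
  have b1 := abs_le.1 ((hdot (x - c)).trans hx)
  have b2 := abs_le.1 ((hdot (x' - c)).trans hx')
  have k1 := abs_planeCross_le e (x - c)
  have k2 := abs_planeCross_le e (x' - c)
  rw [he, one_mul] at k1 k2
  -- Each leg advances by at least `H - R`, so the two lateral excesses add up to at most `R ^ 2 /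
  -- (H - R) ≤ g`, half of the `2 * g` saved by the jump.
  have n1 := norm_le_of_dot (w := x - (c - H • e)) (r := R) (d := H - R) he (by linarith)
    (by rw [d1]; linarith) (by rw [c1]; linarith)
  have n2 := norm_le_of_dot (w := c + H • e - x') (r := R) (d := H - R) he (by linarith)
    (by rw [d2]; linarith) (by rw [c2, abs_neg]; linarith)
  rw [d1] at n1
  rw [d2] at n2
  have h3 : R ^ 2 / (2 * (H - R)) = R ^ 2 / (H - R) / 2 := by
    rw [div_div, mul_comm]
  rw [h3] at n1 n2
  simp only [Complex.sub_re, Complex.sub_im] at *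
  linarith

/-- Radius, in units of the maximal edge length, of the neighbourhood used for one fold. -/
noncomputable def foldReach (q : ℝ) : ℝ := 4 / q ^ 2 + 2

/-- Half-length, in units of the maximal edge length, of a segment shortened by one fold. -/
noncomputable def foldSpan (q : ℝ) : ℝ := foldReach q + 8 * foldReach q ^ 2 / q ^ 2

namespace ColoredDrawing

variable {V F : Type*} {T : ColoredDrawing V F} {O : ℂ → ℂ}

/-- One fold near the midpoint of a long segment shortens its image by a definite amount. -/
theorem IsOrigamiMap.norm_sub_le_sub [Fintype F] {ν : Sym2 V → ℝ} (hT : T.IsTEmbedding ν)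
    (hO : T.IsOrigamiMap O) {S U : Set ℂ} {A q : ℝ} (hA : 0 < A) (hq : 0 < q)
    (hS : ∀ f, (T.face f ∩ S).Nonempty → StrictPolygon (T.pt f) A q)
    (hUo : IsOpen U) (hUc : Convex ℝ U) (hUT : U ⊆ T.region) {c e : ℂ} {H : ℝ} (he : ‖e‖ = 1)
    (hH : foldSpan q * A ≤ H) (hseg : ∀ t : ℝ, |t| ≤ H → c + t • e ∈ S)
    (hseg' : ∀ t : ℝ, |t| ≤ H → c + t • e ∈ U)
    (hball : ∀ z, ‖z - c‖ ≤ foldReach q * A → z ∈ U) :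
    ‖O (c + H • e) - O (c - H • e)‖ ≤ 2 * H - q ^ 2 * A / 8 := by
  have hP := hT.proper
  have hR0 : 0 < foldReach q := by unfold foldReach; positivity
  have hRH : foldReach q * A < H := by
    refine lt_of_lt_of_le ?_ hH
    have : 0 < 8 * foldReach q ^ 2 / q ^ 2 := by positivity
    unfold foldSpan
    nlinarith
  have hHpos : 0 < H := lt_trans (by positivity) hRH
  have hcS : c ∈ S := by simpa using hseg 0 (by simpa using hHpos.le)
  have hcU : c ∈ U := by simpa using hseg' 0 (by simpa using hHpos.le)
  obtain ⟨f, hcf⟩ := Set.mem_iUnion.1 (hUT hcU)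
  have hf := hS f ⟨c, hcf, hcS⟩
  have hq1 : q ≤ 1 := by
    have h1 := hf.turn 0
    have h2 := (le_abs_self _).trans (abs_planeCross_le (T.pt f (0 + 1) - T.pt f 0)
      (T.pt f (0 + 2) - T.pt f (0 + 1)))
    have h3 := hf.len 0
    have h4 := hf.len (0 + 1)
    rw [show (0 : ℤ) + 1 + 1 = 0 + 2 by ring] at h4
    have h5 := mul_le_mul h3 h4 (norm_nonneg _) hA.le
    by_contra hcon
    push Not at hcon
    nlinarith [pow_pos hA 2]
  have hdiam : ∀ z ∈ T.face f, ‖z - c‖ ≤ (4 / q ^ 2 + 1) * A := fun z hz => hf.norm_sub_le hz hcf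
  have hreach : foldReach q * A = (4 / q ^ 2 + 1) * A + A := by unfold foldReach; ring
  obtain ⟨k, hk, x₀, hx₀, hx₀c⟩ := hf.exists_transverse_edge he hcf
  set u := T.pt f k with hu
  set v := T.pt f (k + 1) with hv
  have huf : u ∈ T.face f := T.pt_mem_face f k
  have hvf : v ∈ T.face f := T.pt_mem_face f (k + 1)
  have hmf : u + (1 / 2 : ℝ) • (v - u) ∈ T.face f :=
    (T.convex_face f).add_smul_sub_mem huf hvf ⟨by norm_num, by norm_num⟩
  obtain ⟨g, hug, hvg, hside⟩ := exists_face_across hP hf k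
    (interior_maximal hUT hUo (hball _ ((hdiam _ hmf).trans (by linarith))))
  rw [← hu] at hug
  rw [← hv] at hvg
  rw [← hu, ← hv] at hside
  have hx₀f : x₀ ∈ T.face f := (T.convex_face f).segment_subset huf hvf hx₀
  have hx₀g : x₀ ∈ T.face g := (T.convex_face g).segment_subset hug hvg hx₀
  -- Only faces meeting `S` are known to be rigid. The point `x₀` of the common edge lies on the
  -- given segment, which makes the neighbour `g` rigid as well.
  have hx₀S : x₀ ∈ S := by
    have he2 := Complex.re_sq_add_im_sq_eq e
    rw [he] at he2
    have hpar : x₀ = c + (e.re * (x₀ - c).re + e.im * (x₀ - c).im) • e := by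
      rw [planeCross_eq] at hx₀c
      rw [← sub_eq_iff_eq_add']
      generalize x₀ - c = w at *
      apply Complex.ext
      · simp only [Complex.smul_re, smul_eq_mul]
        linear_combination (-w.re) * he2 - e.im * hx₀c
      · simp only [Complex.smul_im, smul_eq_mul]
        linear_combination (-w.im) * he2 + e.re * hx₀c
    rw [hpar]
    apply hseg
    have h1 := Complex.abs_re_le_norm ((starRingEnd ℂ) e * (x₀ - c))
    have h2 : ((starRingEnd ℂ) e * (x₀ - c)).re = e.re * (x₀ - c).re + e.im * (x₀ - c).im := by
      simp [Complex.mul_re]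
    rw [h2, norm_mul, Complex.norm_conj, he, one_mul] at h1
    linarith [hdiam _ hx₀f]
  have hg := hS g ⟨x₀, hx₀g, hx₀S⟩
  have huv : T.corner f k ≠ T.corner f (k + 1) := by
    intro h
    have := hf.norm_pos k
    rw [pt, pt, h] at this
    simp at this
  obtain ⟨i, hi, hi'⟩ := exists_reversed_edge hP hg huv hug hvg hside
  have hcol : T.black f ≠ T.black g :=
    hT.bipartite f g _ _ ⟨k, rfl, rfl⟩ ⟨i, hi, hi'⟩
  have hmg : u + (1 / 2 : ℝ) • (v - u) ∈ T.face g :=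
    (T.convex_face g).add_smul_sub_mem hug hvg ⟨by norm_num, by norm_num⟩
  have hE : 0 < ‖v - u‖ := hf.norm_pos k
  have hEA : ‖v - u‖ ≤ A := hf.len k
  set m := u + (1 / 2 : ℝ) • (v - u) with hm
  set s : ℝ := q * A / 4 / ‖v - u‖ with hs
  have hspos : 0 < s := by positivity
  have hsE : s * ‖v - u‖ = q * A / 4 := by rw [hs]; field_simp
  have hsq := Complex.re_sq_add_im_sq_eq (v - u)
  have hn1 : ‖(‖v - u‖⁻¹ : ℝ) • (Complex.I * (v - u))‖ = 1 := by
    rw [norm_smul, norm_mul, Complex.norm_I, one_mul, norm_inv, norm_norm,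
      inv_mul_cancel₀ hE.ne']
  have hsn : (q * A / 4) • ((‖v - u‖⁻¹ : ℝ) • (Complex.I * (v - u))) =
      s • (Complex.I * (v - u)) := by
    rw [smul_smul, hs, div_eq_mul_inv (q * A / 4)]
  have hxf : m + s • (Complex.I * (v - u)) ∈ T.face f := by
    have := hf.normal_mem k hn1 (by
      rw [← hu, ← hv]
      have : planeCross (v - u) ((‖v - u‖⁻¹ : ℝ) • (Complex.I * (v - u))) =
          ‖v - u‖⁻¹ * ‖v - u‖ ^ 2 := by
        rw [← hsq]; generalize ‖v - u‖ = r; simp [planeCross_eq]; ring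
      rw [this]; positivity)
    rw [← hu, ← hv, hsn] at this
    exact this
  have hgi : T.pt g i = v := by rw [pt, hi, hv, pt]
  have hgi' : T.pt g (i + 1) = u := by rw [pt, hi', hu, pt]
  have hxg : m - s • (Complex.I * (v - u)) ∈ T.face g := by
    have := hg.normal_mem i (n := -((‖v - u‖⁻¹ : ℝ) • (Complex.I * (v - u))))
      (by rw [norm_neg, hn1]) (by
      rw [hgi, hgi']
      have : planeCross (u - v) (-((‖v - u‖⁻¹ : ℝ) • (Complex.I * (v - u)))) =
          ‖v - u‖⁻¹ * ‖v - u‖ ^ 2 := by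
        rw [← hsq]; generalize ‖v - u‖ = r; simp [planeCross_eq]; ring
      rw [this]; positivity)
    rw [hgi, hgi', smul_neg, hsn, ← sub_eq_add_neg] at this
    have hmid : v + (1 / 2 : ℝ) • (u - v) = m := by
      have h1 : v = (1 / 2 : ℝ) • v + (1 / 2 : ℝ) • v := by rw [← add_smul]; norm_num
      have h2 : u = (1 / 2 : ℝ) • u + (1 / 2 : ℝ) • u := by rw [← add_smul]; norm_num
      rw [hm, smul_sub, smul_sub]
      linear_combination h1 - h2
    rw [hmid] at this
    exact this
  have hfold := hO.eq_of_mirror hcol huf hvf hmf hug hvg hmg hxf hxg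
  set x := m + s • (Complex.I * (v - u)) with hx
  set x' := m - s • (Complex.I * (v - u)) with hx'
  have hxx' : ‖x' - x‖ ≤ A := by
    have : x' - x = -((2 * s) • (Complex.I * (v - u))) := by
      rw [hx, hx', mul_smul, two_smul]; ring
    rw [this, norm_neg, norm_smul, norm_mul Complex.I, Complex.norm_I, one_mul, Real.norm_of_nonneg
      (by positivity), mul_assoc, hsE]
    nlinarith
  have hxR : ‖x - c‖ ≤ foldReach q * A := (hdiam x hxf).trans (by linarith)
  have hx'R : ‖x' - c‖ ≤ foldReach q * A := by
    have := norm_sub_le_norm_sub_add_norm_sub x' x c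
    linarith [hdiam x hxf]
  -- The advance along `e` is `2 * s` times the transversality of the edge, with `s ≥ q / 4` and
  -- transversality at least `q * A / 2`.
  have hgain : q ^ 2 * A / 4 ≤ |e.re * (x' - x).re + e.im * (x' - x).im| := by
    have : e.re * (x' - x).re + e.im * (x' - x).im = (2 * s) * planeCross e (v - u) := by
      rw [hx, hx']; simp [planeCross_eq]; ring
    rw [this, abs_mul, abs_of_nonneg (by positivity)]
    calc q ^ 2 * A / 4 = 2 * (q * A / 4 / A) * (q * A / 2) := by field_simp
      _ ≤ 2 * s * (q * A / 2) := by
        have : q * A / 4 / A ≤ s := by rw [hs]; gcongr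
        gcongr
      _ ≤ _ := by gcongr
  -- The second term of `foldSpan` is chosen so that the detour costs at most half of the advance.
  have hloss : (foldReach q * A) ^ 2 / (H - foldReach q * A) ≤ q ^ 2 * A / 8 := by
    rw [div_le_iff₀ (by linarith)]
    have : 8 * foldReach q ^ 2 / q ^ 2 * A ≤ H - foldReach q * A := by
      unfold foldSpan at hH; linarith
    calc (foldReach q * A) ^ 2 = q ^ 2 * A / 8 * (8 * foldReach q ^ 2 / q ^ 2 * A) := by
          field_simp
      _ ≤ _ := by gcongr
  have hbU : c + H • e ∈ U := hseg' H (abs_of_pos hHpos).le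
  have haU : c - H • e ∈ U := by
    have := hseg' (-H) (by rw [abs_neg]; exact (abs_of_pos hHpos).le)
    rwa [neg_smul, ← sub_eq_add_neg] at this
  have hlip : ∀ {z w}, z ∈ U → w ∈ U → ‖O w - O z‖ ≤ ‖w - z‖ := fun hz hw =>
    hO.norm_sub_le hP ((hUc.segment_subset hz hw).trans hUT)
  have hfinish : ∀ y y' : ℂ, O y = O y' → ‖y - c‖ ≤ foldReach q * A → ‖y' - c‖ ≤ foldReach q * A →
      2 * (q ^ 2 * A / 8) ≤ e.re * (y' - y).re + e.im * (y' - y).im →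
      ‖O (c + H • e) - O (c - H • e)‖ ≤ 2 * H - q ^ 2 * A / 8 := by
    intro y y' hyy hy hy' hdot
    have h1 := detour_le he hRH hy hy' hdot hloss
    have h2 := hlip haU (hball y hy)
    have h3 := hlip (hball y' hy') hbU
    have h4 := norm_sub_le_norm_sub_add_norm_sub (O (c + H • e)) (O y') (O (c - H • e))
    rw [hyy] at h2
    linarith
  -- The sign of the advance decides which mirror point is visited first.
  rcases le_abs'.1 hgain with h | h
  · refine hfinish x' x hfold.symm hx'R hxR ?_
    simp only [Complex.sub_re, Complex.sub_im] at h ⊢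
    linarith
  · exact hfinish x x' hfold hxR hx'R (by linarith)

end ColoredDrawing

/-! ### From a definite loss to a contraction factor. -/

/-- A map that shortens all distances at least `L` by `g` is a contraction at scale `L`. -/
theorem norm_sub_le_mul_of_shortens {O : ℂ → ℂ} {S : Set ℂ} (hS : Convex ℝ S) {L g : ℝ}
    (hL : 0 < L) (hg : 0 < g)
    (h : ∀ a ∈ S, ∀ b ∈ S, L ≤ ‖b - a‖ → ‖O b - O a‖ ≤ ‖b - a‖ - g) {a b : ℂ} (ha : a ∈ S)
    (hb : b ∈ S) (hab : L ≤ ‖b - a‖) : ‖O b - O a‖ ≤ (1 - g / (2 * L)) * ‖b - a‖ := by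
  have key : ∀ n : ℕ, ∀ a ∈ S, ∀ b ∈ S, (n + 1 : ℝ) * L ≤ ‖b - a‖ →
      ‖O b - O a‖ ≤ ‖b - a‖ - (n + 1) * g := by
    intro n
    induction n with
    | zero => intro a ha b hb hab; simpa using h a ha b hb (by simpa using hab)
    | succ n ih =>
      intro a ha b hb hab
      push_cast at hab ⊢
      have hd : L ≤ ‖b - a‖ := by nlinarith [(Nat.cast_nonneg n : (0 : ℝ) ≤ n)]
      have hpos : 0 < ‖b - a‖ := hL.trans_le hd
      have ht1 : L / ‖b - a‖ ≤ 1 := (div_le_one hpos).2 hd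
      have hc : a + (L / ‖b - a‖) • (b - a) ∈ S :=
        hS.add_smul_sub_mem ha hb ⟨by positivity, ht1⟩
      set c := a + (L / ‖b - a‖) • (b - a) with hcdef
      have h1 : ‖c - a‖ = L := by
        rw [hcdef, add_sub_cancel_left, norm_smul, Real.norm_of_nonneg (by positivity)]
        field_simp
      have h2 : ‖b - c‖ = ‖b - a‖ - L := by
        have : b - c = (1 - L / ‖b - a‖) • (b - a) := by
          rw [hcdef, sub_smul, one_smul]; ring
        rw [this, norm_smul, Real.norm_of_nonneg (by linarith)]
        field_simp
      have h3 := h a ha c hc h1.ge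
      have h4 := ih c hc b hb (by rw [h2]; linarith)
      have h5 := norm_sub_le_norm_sub_add_norm_sub (O b) (O c) (O a)
      linarith
  have hk1 : 1 ≤ ⌊‖b - a‖ / L⌋₊ := by
    rw [Nat.one_le_floor_iff, le_div_iff₀ hL]; linarith
  obtain ⟨n, hn⟩ : ∃ n, ⌊‖b - a‖ / L⌋₊ = n + 1 := Nat.exists_eq_succ_of_ne_zero (by omega)
  have hlo : (n + 1 : ℝ) * L ≤ ‖b - a‖ := by
    have := Nat.floor_le (a := ‖b - a‖ / L) (by positivity)
    rw [hn, le_div_iff₀ hL] at this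
    exact_mod_cast this
  have hhi : ‖b - a‖ < (n + 2 : ℝ) * L := by
    have := Nat.lt_floor_add_one (‖b - a‖ / L)
    rw [hn, div_lt_iff₀ hL] at this
    push_cast at this
    linarith
  have h1 := key n a ha b hb hlo
  -- There are `n + 1` pieces, each losing `g`, and the length is less than `(n + 2) * L ≤ 2 * (n +
  -- 1) * L`.
  have h2 : g / (2 * L) * ‖b - a‖ ≤ (n + 1) * g := by
    rw [div_mul_eq_mul_div, div_le_iff₀ (by positivity)]
    have : ‖b - a‖ ≤ (n + 1) * (2 * L) := by nlinarith [(Nat.cast_nonneg n : (0 : ℝ) ≤ n)]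
    nlinarith
  linarith

theorem foldSpan_pos {q : ℝ} (hq : 0 < q) : 0 < foldSpan q := by
  unfold foldSpan foldReach; positivity

namespace ColoredDrawing

variable {V F : Type*} {T : ColoredDrawing V F} {O : ℂ → ℂ}

/-- Here `L = 2 * foldSpan q * A` and the loss is `q ^ 2 * A / 8`, so `A` cancels and the factor
depends on `q` only. The thickening of `S` gives the detour room inside the region. -/
theorem IsOrigamiMap.norm_sub_le_mul [Fintype F] {ν : Sym2 V → ℝ} (hT : T.IsTEmbedding ν)
    (hO : T.IsOrigamiMap O) {S : Set ℂ} (hSc : Convex ℝ S) {A q r : ℝ} (hA : 0 < A) (hq : 0 < q)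
    (hS : ∀ f, (T.face f ∩ S).Nonempty → StrictPolygon (T.pt f) A q)
    (hr : foldReach q * A < r) (hrT : Metric.thickening r S ⊆ T.region) {z z' : ℂ} (hz : z ∈ S)
    (hz' : z' ∈ S) (hzz : 2 * foldSpan q * A ≤ ‖z' - z‖) :
    ‖O z' - O z‖ ≤ (1 - q ^ 2 / (32 * foldSpan q)) * ‖z' - z‖ := by
  have hH := foldSpan_pos hq
  have hR : 0 < foldReach q := by unfold foldReach; positivity
  have hr0 : 0 < r := lt_trans (by positivity) hr
  have key := norm_sub_le_mul_of_shortens (O := O) hSc (L := 2 * foldSpan q * A)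
    (g := q ^ 2 * A / 8) (by positivity) (by positivity) ?_ hz hz' hzz
  · refine key.trans_eq ?_
    congr 2
    field_simp
    norm_num
  intro a ha b hb hab
  have hpos : 0 < ‖b - a‖ := lt_of_lt_of_le (by positivity) hab
  set c := a + (1 / 2 : ℝ) • (b - a) with hc
  set e := (‖b - a‖⁻¹ : ℝ) • (b - a) with he
  have hce : ∀ t : ℝ, c + t • e = a + (1 / 2 + t / ‖b - a‖) • (b - a) := by
    intro t
    rw [hc, he, smul_smul, add_smul, div_eq_mul_inv t, add_assoc]
  have hmem : ∀ t : ℝ, |t| ≤ ‖b - a‖ / 2 → c + t • e ∈ S := by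
    intro t ht
    rw [hce]
    have h1 := (abs_le.1 ht).1
    have h2 := (abs_le.1 ht).2
    refine hSc.add_smul_sub_mem ha hb ⟨?_, ?_⟩
    · have : -(1 / 2) ≤ t / ‖b - a‖ := by rw [le_div_iff₀ hpos]; linarith
      linarith
    · have : t / ‖b - a‖ ≤ 1 / 2 := by rw [div_le_iff₀ hpos]; linarith
      linarith
  have := hO.norm_sub_le_sub hT hA hq hS Metric.isOpen_thickening (hSc.thickening r) hrT
    (c := c) (e := e) (H := ‖b - a‖ / 2)
    (by rw [he, norm_smul, norm_inv, norm_norm, inv_mul_cancel₀ hpos.ne']) (by linarith) hmem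
    (fun t ht => Metric.self_subset_thickening hr0 _ (hmem t ht)) (fun w hw =>
      Metric.mem_thickening_iff.2 ⟨c, by simpa using hmem 0 (by rw [abs_zero]; positivity),
        by rw [dist_eq_norm]; linarith⟩)
  have hb' : c + (‖b - a‖ / 2) • e = b := by
    rw [hce, div_div_cancel_left' hpos.ne']; norm_num
  have ha' : c - (‖b - a‖ / 2) • e = a := by
    rw [sub_eq_add_neg, ← neg_smul, hce, neg_div, div_div_cancel_left' hpos.ne']; norm_num
  rw [hb', ha'] at this
  linarith

end ColoredDrawing

/-! ### Uniformity in `n` and the main theorem. -/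

/-- The convex hull of a compact subset of a convex open set has a compact neighbourhood in it. -/
theorem exists_cthickening_convexHull_subset {K Ω : Set ℂ} (hK : IsCompact K) (hΩ : IsOpen Ω)
    (hΩc : Convex ℝ Ω) (hKΩ : K ⊆ Ω) :
    ∃ r, 0 < r ∧ IsCompact (Metric.cthickening r (convexHull ℝ K)) ∧
      Metric.cthickening r (convexHull ℝ K) ⊆ Ω := by
  obtain ⟨δ, hδ, hsub⟩ := hK.exists_thickening_subset_open hΩ hKΩ
  refine ⟨δ / 2, half_pos hδ, ?_, ?_⟩
  · exact Metric.isCompact_of_isClosed_isBounded Metric.isClosed_cthickening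
      ((isBounded_convexHull.2 hK.isBounded).cthickening)
  · intro z hz
    obtain ⟨w, hw, hzw⟩ := Metric.mem_thickening_iff.1
      (Metric.cthickening_subset_thickening' hδ (half_lt_self hδ) _ hz)
    have hconv : Convex ℝ ((fun x => (z - w) + x) ⁻¹' Ω) := hΩc.translate_preimage_right _
    have : convexHull ℝ K ⊆ (fun x => (z - w) + x) ⁻¹' Ω := by
      refine convexHull_min (fun k hk => hsub ?_) hconv
      refine Metric.mem_thickening_iff.2 ⟨k, hk, ?_⟩
      rw [dist_eq_norm] at hzw ⊢
      simpa using hzw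
    simpa using this hw

theorem exists_lip_of_rigidityCondition {V F : ℕ → Type*} [∀ n, Fintype (F n)]
    {T : ∀ n, ColoredDrawing (V n) (F n)} {ν : ∀ n, Sym2 (V n) → ℝ}
    (hT : ∀ n, (T n).IsTEmbedding (ν n))
    {O : ℕ → ℂ → ℂ} (hO : ∀ n, (T n).IsOrigamiMap (O n)) {Ω : Set ℂ} (hΩopen : IsOpen Ω)
    (hΩconv : Convex ℝ Ω)
    (hExh : ∀ K : Set ℂ, IsCompact K → K ⊆ Ω → ∀ᶠ n in Filter.atTop, K ⊆ (T n).region)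
    {μ : ℕ → ℝ} (hμ : ∀ n, 0 < μ n) (hμ0 : Filter.Tendsto μ Filter.atTop (nhds 0))
    {K : Set ℂ} (hK : IsCompact K) (hKΩ : K ⊆ Ω) {N : ℕ} {C ε : ℝ}
    (hR : RigidityCondition T μ (convexHull ℝ K) N C ε) :
    ∃ κ C' : ℝ, 0 < κ ∧ κ < 1 ∧ 0 < C' ∧ ∀ n, N < n →
      LipOn (O n) K κ (C' * μ n) ∧
      ∀ z ∈ K, ∀ z' ∈ K, C' * μ n < ‖z - z'‖ → ‖O n z - O n z'‖ < κ * ‖z - z'‖ := by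
  obtain ⟨hC, hε, hR⟩ := hR
  rcases K.eq_empty_or_nonempty with rfl | ⟨z₀, hz₀⟩
  · exact ⟨1 / 2, 1, by norm_num, by norm_num, by norm_num, fun n _ => ⟨by simp [LipOn], by simp⟩⟩
  obtain ⟨r, hr, hrc, hrΩ⟩ := exists_cthickening_convexHull_subset hK hΩopen hΩconv hKΩ
  have hreg := hExh _ hrc hrΩ
  -- For large `n` some face contains `z₀` and has an angle in `(ε, π - ε)`; this is why the empty
  -- `K` is treated apart.
  have hεπ : ε < Real.pi := by
    obtain ⟨n, hn, hNn⟩ := (hreg.and (Filter.eventually_gt_atTop N)).exists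
    obtain ⟨f, hf⟩ := Set.mem_iUnion.1
      (hn (Metric.self_subset_cthickening _ (subset_convexHull ℝ K hz₀)))
    have := (hR n hNn f ⟨z₀, hf, subset_convexHull ℝ K hz₀⟩ 0).2.2
    linarith
  have hsin : 0 < Real.sin ε := Real.sin_pos_of_pos_of_lt_pi hε hεπ
  obtain ⟨q, hq, hqdef⟩ : ∃ q : ℝ, 0 < q ∧ q = Real.sin ε / C ^ 4 := ⟨_, by positivity, rfl⟩
  have hH := foldSpan_pos hq
  have hsmall : ∀ᶠ n in Filter.atTop, foldReach q * (μ n * C) < r := by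
    have h1 : Filter.Tendsto (fun n => foldReach q * (μ n * C)) Filter.atTop (nhds 0) := by
      simpa using (hμ0.mul_const C).const_mul (foldReach q)
    exact h1.eventually_lt_const hr
  obtain ⟨N₁, hN₁⟩ := Filter.eventually_atTop.1 (hreg.and hsmall)
  obtain ⟨d, hd⟩ := Metric.isBounded_iff.1 hK.isBounded
  have hd0 : 0 ≤ d := dist_nonneg.trans (hd hz₀ hz₀)
  set κ₀ := 1 - q ^ 2 / (32 * foldSpan q) with hκ₀
  have hκ₀1 : κ₀ < 1 := by
    have : 0 < q ^ 2 / (32 * foldSpan q) := by positivity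
    linarith
  -- Going strictly above `κ₀` gives the strict inequality; the maximum with `1 / 2` ensures
  -- positivity.
  set κ := max ((1 + κ₀) / 2) (1 / 2) with hκ
  have hκκ : κ₀ < κ := lt_of_lt_of_le (by linarith) (le_max_left _ _)
  -- The sum makes `C' * μ n` exceed the diameter bound `d` of `K` for the finitely many `n < N₁`,
  -- where the claim becomes vacuous.
  set C' := 2 * foldSpan q * C + ∑ n ∈ Finset.range N₁, (d + 1) / μ n with hC'
  have hsum : 0 ≤ ∑ n ∈ Finset.range N₁, (d + 1) / μ n :=
    Finset.sum_nonneg fun n _ => div_nonneg (by linarith) (hμ n).le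
  have hC'0 : 0 < C' := by positivity
  have hstrict : ∀ n, N < n → ∀ z ∈ K, ∀ z' ∈ K, C' * μ n ≤ ‖z - z'‖ →
      ‖O n z - O n z'‖ < κ * ‖z - z'‖ := by
    intro n hn z hz z' hz' hzz
    have hμn := hμ n
    have hpos : 0 < ‖z - z'‖ := lt_of_lt_of_le (by positivity) hzz
    rcases lt_or_ge n N₁ with hnN | hnN
    · exfalso
      have h1 : (d + 1) / μ n ≤ ∑ n ∈ Finset.range N₁, (d + 1) / μ n :=
        Finset.single_le_sum (f := fun n => (d + 1) / μ n)
          (fun m _ => div_nonneg (by linarith) (hμ m).le) (Finset.mem_range.2 hnN)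
      have h2 : (d + 1) / μ n ≤ C' := by
        have : 0 < 2 * foldSpan q * C := by positivity
        linarith
      rw [div_le_iff₀ hμn] at h2
      have h3 := hd hz hz'
      rw [dist_eq_norm] at h3
      linarith
    · obtain ⟨hreg, hsm⟩ := hN₁ n hnN
      have h1 := (hO n).norm_sub_le_mul (hT n) (convex_convexHull ℝ K) (A := μ n * C) (q := q)
        (r := r) (by positivity) hq (fun f hf => by
          rw [hqdef]
          exact ColoredDrawing.strictPolygon_of_rigid (hT n).proper hμn hC hε (hR n hn) hf)
        hsm ((Metric.thickening_subset_cthickening _ _).trans hreg)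
        (subset_convexHull ℝ K hz') (subset_convexHull ℝ K hz) (by
          refine le_trans ?_ hzz
          have : 2 * foldSpan q * C ≤ C' := by linarith
          nlinarith)
      exact h1.trans_lt (mul_lt_mul_of_pos_right hκκ hpos)
  refine ⟨κ, C', lt_of_lt_of_le (by norm_num) (le_max_right _ _),
    max_lt (by linarith) (by norm_num), hC'0, fun n hn => ⟨?_, ?_⟩⟩
  · intro z hz z' hz' hzz
    exact (hstrict n hn z' hz' z hz hzz).le
  · intro z hz z' hz' hzz
    exact hstrict n hn z hz z' hz' hzz.le

theorem mainTheorem8 {V F : ℕ → Type*} [∀ n, Fintype (F n)]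
    (T : ∀ n, ColoredDrawing (V n) (F n)) (ν : ∀ n, Sym2 (V n) → ℝ)
    (hT : ∀ n, (T n).IsTEmbedding (ν n))
    (O : ℕ → ℂ → ℂ) (hO : ∀ n, (T n).IsOrigamiMap (O n))
    (D : ℕ) (hD : ∀ n v, (T n).degree v < D)
    (Ω : Set ℂ) (hΩopen : IsOpen Ω) (hΩne : Ω.Nonempty) (hΩconv : Convex ℝ Ω)
    (hΩbdd : Bornology.IsBounded Ω)
    (hHaus : Filter.Tendsto (fun n => Metric.hausdorffDist (T n).region Ω)
      Filter.atTop (nhds 0))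
    (hExh : ∀ K : Set ℂ, IsCompact K → K ⊆ Ω → ∀ᶠ n in Filter.atTop, K ⊆ (T n).region) :
    (∀ μ : ℕ → ℝ, (∀ n, 0 < μ n) → Filter.Tendsto μ Filter.atTop (nhds 0) →
      ∀ K : Set ℂ, IsCompact K → K ⊆ Ω →
      ∀ (N : ℕ) (C ε : ℝ), RigidityCondition T μ (convexHull ℝ K) N C ε →
        ∃ κ C' : ℝ, 0 < κ ∧ κ < 1 ∧ 0 < C' ∧ ∀ n, N < n →
          LipOn (O n) K κ (C' * μ n) ∧
          ∀ z ∈ K, ∀ z' ∈ K, C' * μ n < ‖z - z'‖ → ‖O n z - O n z'‖ < κ * ‖z - z'‖) ∧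
    ((∀ K : Set ℂ, IsCompact K → K ⊆ Ω →
        ∃ (N : ℕ) (C ε : ℝ), RigidityCondition T (fun n => 1 / (n : ℝ)) K N C ε) →
      LipOnCompacts O Ω (fun n => Real.log n / n)) := by
  have hprop := fun (μ : ℕ → ℝ) (hμ : ∀ n, 0 < μ n)
      (hμ0 : Filter.Tendsto μ Filter.atTop (nhds 0)) (K : Set ℂ) (hK : IsCompact K)
      (hKΩ : K ⊆ Ω) (N : ℕ) (C ε : ℝ)
      (hR : RigidityCondition T μ (convexHull ℝ K) N C ε) =>
    exists_lip_of_rigidityCondition hT hO hΩopen hΩconv hExh hμ hμ0 hK hKΩ hR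
  refine ⟨hprop, fun hrig => ⟨?_, fun K hK hKΩ => ?_⟩⟩
  · have := Real.isLittleO_log_id_atTop.tendsto_div_nhds_zero.comp tendsto_natCast_atTop_atTop
    exact this
  · obtain ⟨r, hr, hrc, hrΩ⟩ := exists_cthickening_convexHull_subset hK hΩopen hΩconv hKΩ
    obtain ⟨N, C, ε, hC, hε, hR⟩ := hrig _ hrc hrΩ
    -- In Lean `1 / 0 = 0`, so the scale at `n = 0` is changed to be positive; rigidity concerns
    -- only `n > N`.
    let μ : ℕ → ℝ := fun n => if n = 0 then 1 else 1 / (n : ℝ)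
    have hμn : ∀ n, n ≠ 0 → μ n = 1 / (n : ℝ) := fun n hn => if_neg hn
    have hμ : ∀ n, 0 < μ n := by
      intro n
      rcases Nat.eq_zero_or_pos n with rfl | hn
      · simp [μ]
      · rw [hμn n hn.ne']; positivity
    have hμ0 : Filter.Tendsto μ Filter.atTop (nhds 0) := by
      refine tendsto_one_div_atTop_nhds_zero_nat.congr' ?_
      filter_upwards [Filter.eventually_gt_atTop 0] with n hn
      rw [hμn n hn.ne']
    obtain ⟨κ, C', h0, h1, hC', h⟩ := hprop μ hμ hμ0 K hK hKΩ N C ε ⟨hC, hε, fun n hn f hf => by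
      rw [hμn n (by omega)]
      exact hR n hn f (hf.mono (Set.inter_subset_inter_right _
        (Metric.self_subset_cthickening _)))⟩
    refine ⟨κ, h0, h1, ?_⟩
    -- Once `log n ≥ C'`, the scale `log n / n` is at least `C' / n`.
    have hlog := (Real.tendsto_log_atTop.comp tendsto_natCast_atTop_atTop).eventually_ge_atTop C'
    filter_upwards [hlog, Filter.eventually_gt_atTop N] with n hn hNn z hz z' hz' hzz
    refine (h n hNn).1 z hz z' hz' (le_trans ?_ hzz)
    rw [hμn n (by omega), mul_one_div]
    exact div_le_div_of_nonneg_right hn (Nat.cast_nonneg n)
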